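/- Let $p$ be a prime, $F=\mathbb{Q}_p$, $K/F$ a finite field extension with maximal order $\mathfrak{o}$ and maximal ideal $\mathfrak{p}\subset\mathfrak{o}$. Let $E$ be an étale $K$-algebra of dimension $2$ (a quadratic field extension of $K$, or $E\cong K\times K$), with maximal order $\mathcal{O}$ and non-trivial $K$-automorphism $x\mapsto\bar x$, and let $\mathfrak{P}\subsetneq\mathcal{O}$ be the largest proper ideal of $\mathcal{O}$ that is invariant under $x\mapsto\bar x$. Let $\mathfrak{D}_{E/F}^{-1}=\{x\in E\mid \mathrm{Tr}_{E/F}(x\mathcal{O})\subseteq\mathbb{Z}_p\}$, similarly $\mathfrak{D}_{K/F}^{-1}$, and define $a$ by $\mathfrak{P}^a=\mathfrak{D}_{E/F}$. For an integer $i\ge 0$ put $$\mathcal{E}^{i}=\{u\in\mathcal{O}^\times \mid u\bar u=1,\ u\equiv 1 \bmod \mathfrak{P}^{i}\}.$$ Let $V$ be an $E$-module with a non-degenerate hermitian form $h$, and let $L\neq 0$ be a full $\mathcal{O}$-lattice in $V$, that is, a finitely generated $\mathcal{O}$-submodule spanning $V$ over $E$. Its norm is the fractional ideal $\mathfrak{n}(L)=\sum_{x\in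 L}h(x,x)\mathfrak{o}$ of $K$; write $\mathfrak{n}(L)=\mathfrak{p}^k$ with $k \in \mathbb{Z}$, and suppose that $\mathfrak{p}^k\subseteq\mathfrak{D}_{K/F}^{-1}$ (equivalently, the trace form $\mathrm{Tr}_{E/F}\circ h$ on $L$ is even, so that $L\subseteq L^\vee$ for the dual lattice $L^\vee=\{x\in V\mid \mathrm{Tr}_{E/F}\,h(x,L)\subseteq\mathbb{Z}_p\}$). Let $U(L)$ be the group of $E$-linear isometries $\varphi$ of $(V,h)$ with $\varphi(L)=L$, and let $U^\sharp(L)$ be the kernel of its natural action on the discriminant module $D_L=L^\vee/L$. Then $$\det(U^\sharp(L))=\begin{cases}\mathcal{E}^{2k+a} & \text{if } E/K \text{ is a ramified field extension},\\ \mathcal{E}^{k+a} & \text{if } E/K \text{ is an unramified field extension or } E\cong K\times K.\end{cases}$$ -/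

import Mathlib

namespace LocalHermitian

noncomputable section

/-- The maximal order of a finite étale `ℚ_[p]`-algebra `A`: the integral closure of `ℤ_[p]`. -/
abbrev maxOrder (p : ℕ) [Fact p.Prime] (A : Type*) [CommRing A] [Algebra ℤ_[p] A] :
    Subalgebra ℤ_[p] A :=
  integralClosure ℤ_[p] A

/-- Integral powers of a fractional ideal `I` (an `R`-submodule of `A`): the usual powers for
nonnegative exponents, and `I ^ (-n) = (R : I ^ n) = {x | x • I ^ n ⊆ R}` for negative ones. -/
def zpowIdeal {R A : Type*} [CommRing R] [CommRing A] [Algebra R A] (I : Submodule R A) :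
    ℤ → Submodule R A
  | Int.ofNat n => I ^ n
  | Int.negSucc n => 1 / I ^ (n + 1)

section Orders

variable (p : ℕ) [Fact p.Prime]

/-- The inverse different `{x ∈ A | Tr (x 𝒪_A) ⊆ ℤ_p}` of `A` over `ℚ_p`. -/
def inverseDifferent (A : Type*) [CommRing A] [Algebra ℤ_[p] A] [Algebra ℚ_[p] A] :
    Submodule (maxOrder p A) A where
  carrier := {x | ∀ y ∈ maxOrder p A,
    Algebra.trace ℚ_[p] A (x * y) ∈ (algebraMap ℤ_[p] ℚ_[p]).range}
  zero_mem' := by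
    intro y _
    simp only [zero_mul, map_zero]
    exact zero_mem _
  add_mem' := by
    intro x x' hx hx' y hy
    rw [add_mul, map_add]
    exact add_mem (hx y hy) (hx' y hy)
  smul_mem' := by
    intro c x hx y hy
    have h := hx ((c : A) * y) (mul_mem c.2 hy)
    have e : (c • x) * y = x * ((c : A) * y) := by
      rw [Subalgebra.smul_def, smul_eq_mul]; ring
    rw [e]
    exact h

/-- The absolute different `(𝒪_A : 𝔇⁻¹)`, the inverse of the inverse different. -/
def different (A : Type*) [CommRing A] [Algebra ℤ_[p] A] [Algebra ℚ_[p] A] :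
    Submodule (maxOrder p A) A :=
  1 / inverseDifferent p A

/-- The largest proper ideal of the maximal order of a local field `K`,
as a fractional ideal: `𝔭`. -/
def maxIdeal (K : Type*) [Field K] [Algebra ℤ_[p] K] : Submodule (maxOrder p K) K :=
  sSup {I | I < 1}

variable {K E : Type*} [Field K] [CommRing E] [Algebra K E] [Algebra ℤ_[p] K] [Algebra ℤ_[p] E]

/-- The largest proper ideal of the maximal order of `E` that is invariant under `σ`,
as a fractional ideal: `𝔓`. -/
def invIdeal (σ : E ≃ₐ[K] E) : Submodule (maxOrder p E) E :=
  sSup {I | I < 1 ∧ ∀ x ∈ I, σ x ∈ I}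

/-- The extension `I 𝒪_E` of a fractional ideal `I` of `K`. -/
def extendIdeal (E : Type*) [CommRing E] [Algebra K E] [Algebra ℤ_[p] E]
    (I : Submodule (maxOrder p K) K) : Submodule (maxOrder p E) E :=
  Submodule.span (maxOrder p E) (algebraMap K E '' (I : Set K))

/-- `E/K` is a ramified field extension: `E` is a field, and `𝔭 𝒪_E` is not the maximal ideal `𝔓`
of `𝒪_E`. (Otherwise `E/K` is an unramified field extension or `E ≅ K × K`.) -/
def IsRamified (σ : E ≃ₐ[K] E) : Prop :=
  IsField E ∧ extendIdeal p E (maxIdeal p K) ≠ invIdeal p σ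

/-- The group `ℰ^i` of all units `u` of `𝒪_E` with `u σ(u) = 1` and `u ≡ 1 mod 𝔓 ^ i`. -/
def normOneUnits (σ : E ≃ₐ[K] E) (i : ℤ) : Subgroup Eˣ where
  carrier := {u | (u : E) ∈ maxOrder p E ∧ ((u⁻¹ : Eˣ) : E) ∈ maxOrder p E ∧
    (u : E) * σ u = 1 ∧ (u : E) - 1 ∈ zpowIdeal (invIdeal p σ) i}
  one_mem' := by simp [one_mem]
  mul_mem' := by
    rintro u v ⟨hu, hu', hu1, hui⟩ ⟨hv, hv', hv1, hvi⟩
    refine ⟨?_, ?_, ?_, ?_⟩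
    · rw [Units.val_mul]; exact mul_mem hu hv
    · rw [mul_inv, Units.val_mul]; exact mul_mem hu' hv'
    · rw [Units.val_mul, map_mul]
      linear_combination (v : E) * σ v * hu1 + hv1
    · have h := add_mem (Submodule.smul_mem _ (⟨(u : E), hu⟩ : maxOrder p E) hvi) hui
      rw [Subalgebra.smul_def, smul_eq_mul] at h
      have e : ((u * v : Eˣ) : E) - 1 = (u : E) * ((v : E) - 1) + ((u : E) - 1) := by
        rw [Units.val_mul]; ring
      rw [e]
      exact h
  inv_mem' := by
    rintro u ⟨hu, hu', hu1, hui⟩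
    have hinv : ((u⁻¹ : Eˣ) : E) = σ u :=
      Units.inv_eq_of_mul_eq_one_right hu1
    refine ⟨hu', by rwa [inv_inv], ?_, ?_⟩
    · have h1 : (u : E) * ((u⁻¹ : Eˣ) : E) = 1 := Units.mul_inv u
      have h2 : σ (u : E) * σ ((u⁻¹ : Eˣ) : E) = 1 := by rw [← map_mul, h1, map_one]
      rw [hinv] at h2 ⊢
      exact h2
    · have h := neg_mem (Submodule.smul_mem _ (⟨_, hu'⟩ : maxOrder p E) hui)
      rw [Subalgebra.smul_def, smul_eq_mul] at h
      have e : ((u⁻¹ : Eˣ) : E) - 1 = -(((u⁻¹ : Eˣ) : E) * ((u : E) - 1)) := by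
        rw [mul_sub, Units.inv_mul]; ring
      rw [e]
      exact h

end Orders

/-- A non-degenerate hermitian form on the `E`-module `V`, linear in the first variable and
semilinear with respect to the involution `σ` in the second. -/
structure HermitianForm {K E : Type*} [Field K] [CommRing E] [Algebra K E] (σ : E ≃ₐ[K] E)
    (V : Type*) [AddCommGroup V] [Module E V] where
  /-- the underlying sesquilinear form -/
  form : V →ₗ[E] V →ₛₗ[(σ : E →+* E)] E
  conj_symm : ∀ x y, form x y = σ (form y x)
  nondegenerate : ∀ x, (∀ y, form x y = 0) → x = 0

section Lattices

variable (p : ℕ) [Fact p.Prime] {K E : Type*} [Field K] [CommRing E] [Algebra K E]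
  [Algebra ℤ_[p] K] [Algebra ℤ_[p] E] [IsScalarTower ℤ_[p] K E] [Algebra ℚ_[p] E]
  {σ : E ≃ₐ[K] E} {V : Type*} [AddCommGroup V] [Module E V]

/-- A (full) `𝒪_E`-lattice in `V`: a finitely generated `𝒪_E`-submodule that spans `V` over `E`. -/
structure IsFullLattice (L : Submodule (maxOrder p E) V) : Prop where
  fg : L.FG
  span_eq_top : Submodule.span E (L : Set V) = ⊤

/-- The norm of `L`: the fractional ideal of `K` generated by all `h(x, x) ∈ K`, `x ∈ L`. -/
def latticeNorm (H : HermitianForm σ V) (L : Submodule (maxOrder p E) V) :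
    Submodule (maxOrder p K) K :=
  Submodule.span (maxOrder p K) {c | ∃ x ∈ L, algebraMap K E c = H.form x x}

/-- The dual lattice `L^∨` of `L` with respect to the trace form `Tr_{E/ℚ_p} ∘ h`. -/
def traceDual (H : HermitianForm σ V) (L : Submodule (maxOrder p E) V) :
    Submodule (maxOrder p E) V where
  carrier := {x | ∀ y ∈ L,
    Algebra.trace ℚ_[p] E (H.form x y) ∈ (algebraMap ℤ_[p] ℚ_[p]).range}
  zero_mem' := by
    intro y _
    simp only [map_zero, LinearMap.zero_apply]
    exact zero_mem _
  add_mem' := by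
    intro x x' hx hx' y hy
    rw [map_add, LinearMap.add_apply, map_add]
    exact add_mem (hx y hy) (hx' y hy)
  smul_mem' := by
    intro c x hx y hy
    have hc : σ.symm (c : E) ∈ maxOrder p E :=
      IsIntegral.map ((σ.symm : E →ₐ[K] E).restrictScalars ℤ_[p]) c.2
    have h := hx ((⟨_, hc⟩ : maxOrder p E) • y) (L.smul_mem _ hy)
    have e : H.form (c • x) y = H.form x ((⟨_, hc⟩ : maxOrder p E) • y) := by
      rw [Subalgebra.smul_def, Subalgebra.smul_def, map_smul, LinearMap.smul_apply,
        LinearMap.map_smulₛₗ]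
      simp
    rw [e]
    exact h

/-- The discriminant module `D_L = L^∨ / L`. -/
abbrev discModule (H : HermitianForm σ V) (L : Submodule (maxOrder p E) V) : Type _ :=
  traceDual p H L ⧸ L.submoduleOf (traceDual p H L)

/-- The unitary group `U(L)`: all `E`-linear isometries of `V` that map `L` onto itself. -/
def unitaryGroup (H : HermitianForm σ V) (L : Submodule (maxOrder p E) V) :
    Subgroup (V ≃ₗ[E] V) where
  carrier := {φ | (∀ x y, H.form (φ x) (φ y) = H.form x y) ∧ ∀ x, φ x ∈ L ↔ x ∈ L}
  one_mem' := ⟨fun _ _ => rfl, fun _ => Iff.rfl⟩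
  mul_mem' := by
    rintro φ ψ ⟨h1, h2⟩ ⟨h3, h4⟩
    exact ⟨fun x y => (h1 _ _).trans (h3 x y), fun x => (h2 _).trans (h4 x)⟩
  inv_mem' := by
    rintro φ ⟨h1, h2⟩
    refine ⟨fun x y => ?_, fun x => ?_⟩
    · have h := h1 (φ.symm x) (φ.symm y)
      rw [φ.apply_symm_apply, φ.apply_symm_apply] at h
      exact h.symm
    · have h := h2 (φ.symm x)
      rw [φ.apply_symm_apply] at h
      exact h.symm

variable {p} in
theorem map_mem_traceDual {H : HermitianForm σ V} {L : Submodule (maxOrder p E) V}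
    (φ : unitaryGroup p H L) {x : V} (hx : x ∈ traceDual p H L) :
    (φ : V ≃ₗ[E] V) x ∈ traceDual p H L := by
  intro y hy
  have hy' : (φ : V ≃ₗ[E] V).symm y ∈ L := by
    rw [← φ.2.2, LinearEquiv.apply_symm_apply]; exact hy
  have e := φ.2.1 x ((φ : V ≃ₗ[E] V).symm y)
  rw [LinearEquiv.apply_symm_apply] at e
  rw [e]
  exact hx _ hy'

/-- The action of `U(L)` on `L^∨`. -/
def dualAction (H : HermitianForm σ V) (L : Submodule (maxOrder p E) V)
    (φ : unitaryGroup p H L) : traceDual p H L →ₗ[maxOrder p E] traceDual p H L :=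
  (((φ : V ≃ₗ[E] V) : V →ₗ[E] V).restrictScalars (maxOrder p E)).restrict
    fun _ hx => map_mem_traceDual φ hx

/-- The natural action `φ ↦ D_φ` of `U(L)` on the discriminant module, `D_φ [x] = [φ x]`.
If the trace form on `L` is even, `D_φ` lies in the group `U(D_L)` of automorphisms of `D_L`
that preserve the discriminant form; the kernel does not depend on the chosen codomain. -/
def discAction (H : HermitianForm σ V) (L : Submodule (maxOrder p E) V) :
    unitaryGroup p H L →* Module.End (maxOrder p E) (discModule p H L) where
  toFun φ := Submodule.mapQ _ _ (dualAction p H L φ) fun x hx => (φ.2.2 x).2 hx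
  map_one' := by
    refine LinearMap.ext fun x => ?_
    induction x using Submodule.Quotient.induction_on
    rfl
  map_mul' := by
    intro φ ψ
    refine LinearMap.ext fun x => ?_
    induction x using Submodule.Quotient.induction_on
    rfl

/-- `U^♯(L)`: the kernel of the action of `U(L)` on `D_L`. -/
def unitarySharp (H : HermitianForm σ V) (L : Submodule (maxOrder p E) V) :
    Subgroup (unitaryGroup p H L) :=
  (discAction p H L).ker

/-- The group `ℱ^♯(L) = det U^♯(L)` of determinants of the elements of `U^♯(L)`. -/
def detSharp (H : HermitianForm σ V) (L : Submodule (maxOrder p E) V) : Subgroup Eˣ :=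
  (unitarySharp p H L).map (LinearEquiv.det.comp (unitaryGroup p H L).subtype)

end Lattices

end

end LocalHermitian

/-! Let `θ` generate `𝒪` over `𝔬` and put `d = θ - σ θ`; let `δ` generate the different of `K/ℚ_p`
and let `c` generate the norm of `L`. Then `𝔇_{E/F} = δ d 𝒪`, and evenness says that `e = c δ` lies
in `𝔬`. Both cases of the theorem become one statement: the determinants are exactly the units `u`
with `u σ(u) = 1` and `u ≡ 1` modulo `e d`. The two exponents only reflect whether `𝔭𝒪` is `𝔓²` or
`𝔓`.

Every such unit occurs (`exists_sharp_det_eq`). Some `x ∈ L` has `h(x, x)` generating the norm. The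
quasi-reflection `y ↦ y + (u - 1) h(y, x) h(x, x)⁻¹ x` has determinant `u`, and its coefficient is
integral for `y ∈ L^∨` because `h(L^∨, L) ⊆ (δ d)⁻¹ 𝒪`.

No other unit occurs (`det_mem_of_sharp`). Lattices are free, and in coordinates an isometry trivial
on `L^∨ / L` has determinant `u = det (1 + HΓ)`, where `Γ` is divisible by `e`, `H` is the Gram
matrix scaled by `d / c`, and `Γ = Γᴴ + Γᴴ H Γ`. Since the diagonal of the Gram matrix lies in `c
𝔬`, the skew-hermitian `H` is even: `H = T - Tᴴ` with `T` integral. For `z = det (1 - Tᴴ Γ)` this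
gives `u σ(z) = z` (`det_one_add_mul_star_det`). As `z = 1 + e y`, and `y - σ y ∈ d 𝒪` for integral
`y`, it follows that `u - 1 = (z - σ z) / σ z ∈ e d 𝒪`, provided `z` is a unit.

If `e` is not a unit, then neither is the difference `z - 1`, and `z` is a unit by a norm
computation. If `e` is a unit and `E/K` is not ramified, the congruence holds for every norm-one
unit. In the ramified case `T` may be altered by a hermitian matrix; `σ` is trivial on the residue
field, and the fact that a Lagrangian subspace is transversal to the graph of some symmetric matrix
(`exists_isSymm_det_sub_mul_ne_zero`) makes `z` a unit. -/

namespace LocalHermitian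

set_option linter.unusedSectionVars false

/-! ### Matrix identities for even skew-hermitian forms, and Lagrangian transversality -/

section EvenForms

open Matrix

/-- A determinant identity for an isometry `1 + H Γ` when the skew-hermitian matrix
`H = T - Tᴴ` is even. -/
theorem det_one_add_mul_star_det {R n : Type*} [CommRing R] [StarRing R] [Fintype n]
    [DecidableEq n] {T Γ : Matrix n n R} (h : Γ = Γᴴ + Γᴴ * (T - Tᴴ) * Γ) :
    (1 + (T - Tᴴ) * Γ).det * star (1 - Tᴴ * Γ).det = (1 - Tᴴ * Γ).det := by
  -- Taking determinants here suffices: `det (1 - T Γᴴ) = det (1 - Γᴴ T)`, which is the conjugate of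
  -- `det (1 - Tᴴ Γ)`.
  have e : (1 - T * Γᴴ) * (1 + (T - Tᴴ) * Γ) = 1 - Tᴴ * Γ := by
    have : (1 - T * Γᴴ) * (1 + (T - Tᴴ) * Γ)
        = 1 + (T - Tᴴ) * Γ - T * (Γᴴ + Γᴴ * (T - Tᴴ) * Γ) := by noncomm_ring
    rw [this, ← h]; noncomm_ring
  rw [← det_conjTranspose]
  simp only [conjTranspose_sub, conjTranspose_one, conjTranspose_mul, conjTranspose_conjTranspose]
  rw [det_one_sub_mul_comm Γᴴ T, mul_comm, ← det_mul, e]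

theorem star_det_mul_det_one_add {R n : Type*} [CommRing R] [StarRing R] [Fintype n]
    [DecidableEq n] {H Γ : Matrix n n R} (hH : Hᴴ = -H) (h : Γ = Γᴴ + Γᴴ * H * Γ) :
    star (1 + H * Γ).det * (1 + H * Γ).det = 1 := by
  have e : (1 - H * Γᴴ) * (1 + H * Γ) = 1 := by
    have : (1 - H * Γᴴ) * (1 + H * Γ) = 1 + H * Γ - H * (Γᴴ + Γᴴ * H * Γ) := by noncomm_ring
    rw [this, ← h]; noncomm_ring
  rw [← det_conjTranspose]
  simp only [conjTranspose_add, conjTranspose_one, conjTranspose_mul, hH]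
  rw [mul_neg, ← sub_eq_add_neg, det_one_sub_mul_comm Γᴴ H, ← det_mul, e, det_one]

theorem exists_det_one_sub_mul_smul_eq {R n : Type*} [CommRing R] [Fintype n]
    [DecidableEq n] (A B : Matrix n n R) (e : R) :
    ∃ y, (1 - A * (e • B)).det = 1 + e * y := by
  have h : Ideal.Quotient.mk (Ideal.span {e}) ((1 - A * (e • B)).det) =
      Ideal.Quotient.mk (Ideal.span {e}) 1 := by
    rw [RingHom.map_det, map_one]
    have : (Ideal.Quotient.mk (Ideal.span {e})).mapMatrix (1 - A * (e • B)) = 1 := by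
      rw [map_sub, map_one, Matrix.mul_smul]
      ext i j
      simp
    rw [this, det_one]
  rw [Ideal.Quotient.mk_eq_mk_iff_sub_mem, Ideal.mem_span_singleton] at h
  obtain ⟨y, hy⟩ := h
  exact ⟨y, by linear_combination hy⟩

/-- A Lagrangian subspace, given as the range of `x ↦ (M x, G x)`, is transversal to the graph of
some symmetric matrix. -/
theorem exists_isSymm_det_sub_mul_ne_zero {k n : Type*} [Field k] [Fintype n] [DecidableEq n]
    {M G : Matrix n n k} (hs : (Gᵀ * M).IsSymm)
    (hker : ∀ x, G *ᵥ x = 0 → M *ᵥ x = 0 → x = 0) :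
    ∃ S : Matrix n n k, S.IsSymm ∧ (M - S * G).det ≠ 0 := by
  -- Changing bases on both sides makes `G` diagonal; the symmetry hypothesis then reads `Nᵀ Δ = Δ
  -- N`. This works over every field, including finite fields and characteristic 2.
  obtain ⟨l, l', D, hG⟩ := Pivot.exists_list_transvec_mul_diagonal_mul_list_transvec G
  set L := (l.map TransvectionStruct.toMatrix).prod with hL
  set L' := (l'.map TransvectionStruct.toMatrix).prod with hL'
  have hLu : IsUnit L.det := by rw [hL, TransvectionStruct.det_toMatrix_prod]; exact isUnit_one
  have hLu' : IsUnit L'.det := by rw [hL', TransvectionStruct.det_toMatrix_prod]; exact isUnit_one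
  have hLt : IsUnit Lᵀ.det := by rwa [det_transpose]
  have hLt' : IsUnit L'ᵀ.det := by rwa [det_transpose]
  set Δ : Matrix n n k := diagonal D with hΔ
  set Δi : Matrix n n k := diagonal (fun i => (D i)⁻¹) with hΔi
  set N := Lᵀ * M * L'⁻¹ with hN
  have hNM : N * L' = Lᵀ * M := by
    rw [hN, Matrix.mul_assoc, nonsing_inv_mul _ hLu', Matrix.mul_one]
  have hΔt : Δᵀ = Δ := diagonal_transpose _
  have hΔit : Δiᵀ = Δi := diagonal_transpose _
  have hsymm : Nᵀ * Δ = Δ * N := by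
    have h1 : L'ᵀ * (Nᵀ * Δ) * L' = L'ᵀ * (Δ * N) * L' := by
      have h2 : Gᵀ * M = L'ᵀ * (Δ * N) * L' := by
        rw [hG, transpose_mul, transpose_mul, hΔt]
        simp only [Matrix.mul_assoc]
        rw [hNM]
      have h3 := hs.eq
      rw [h2, transpose_mul, transpose_mul, transpose_mul, transpose_transpose, hΔt] at h3
      simpa only [Matrix.mul_assoc] using h3
    have h4 := congrArg (fun X => L'ᵀ⁻¹ * X * L'⁻¹) h1
    simp only [Matrix.mul_assoc, mul_nonsing_inv _ hLu', Matrix.mul_one] at h4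
    simpa only [← Matrix.mul_assoc, nonsing_inv_mul _ hLt', Matrix.one_mul] using h4
  have hp : Δ * (Δi * Δ) = Δ := by
    simp only [hΔ, hΔi, diagonal_mul_diagonal]
    congr 1; ext i
    by_cases h : D i = 0
    · simp [h]
    · field_simp
  -- With `Δi` the pseudo-inverse of `Δ` and `P = Δi Δ` the projection onto its support, this choice
  -- gives `S' Δ = P N - P`, so `P (N - S' Δ) = P`. A vector killed by `N - S' Δ` is therefore
  -- killed by `Δ`, and then by `N`.
  set S' := Δi * (Δ * N) * Δi - Δi with hS'
  have hS't : S'ᵀ = S' := by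
    rw [hS']
    simp only [transpose_sub, transpose_mul, hΔt, hΔit, hsymm]
    simp only [Matrix.mul_assoc]
  have hSΔ : S' * Δ = Δi * Δ * N - Δi * Δ := by
    rw [hS', Matrix.sub_mul]
    congr 1
    rw [← hsymm, Matrix.mul_assoc, Matrix.mul_assoc, Matrix.mul_assoc, hp, hsymm, Matrix.mul_assoc]
  refine ⟨Lᵀ⁻¹ * S' * L⁻¹, ?_, fun hdet => ?_⟩
  · rw [IsSymm, transpose_mul, transpose_mul, hS't, transpose_nonsing_inv, transpose_nonsing_inv,
      transpose_transpose, Matrix.mul_assoc]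
  obtain ⟨x, hx0, hx⟩ := exists_mulVec_eq_zero_iff.2 hdet
  apply hx0
  set y := L' *ᵥ x with hy
  have h1 : Lᵀ * (M - Lᵀ⁻¹ * S' * L⁻¹ * G) = (N - S' * Δ) * L' := by
    rw [Matrix.mul_sub, Matrix.sub_mul, hNM, hG]
    congr 1
    simp only [← Matrix.mul_assoc, mul_nonsing_inv _ hLt, Matrix.one_mul]
    rw [Matrix.mul_assoc S', nonsing_inv_mul _ hLu, Matrix.mul_one]
  have h2 : (N - S' * Δ) *ᵥ y = 0 := by
    rw [hy, mulVec_mulVec, ← h1, ← mulVec_mulVec, hx, mulVec_zero]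
  have h3 : Δ *ᵥ y = 0 := by
    have : Δ *ᵥ ((N - S' * Δ) *ᵥ y) = Δ *ᵥ y := by
      rw [mulVec_mulVec, hSΔ, Matrix.mul_sub, Matrix.mul_sub, ← Matrix.mul_assoc Δ _ N, hp,
        sub_sub_cancel]
    rw [← this, h2, mulVec_zero]
  have h4 : N *ᵥ y = 0 := by
    have h5 : (Δi * (Nᵀ * Δ)) *ᵥ y = 0 := by
      rw [← Matrix.mul_assoc, ← mulVec_mulVec, h3, mulVec_zero]
    have h6 : (Δi * Δ) *ᵥ y = 0 := by rw [← mulVec_mulVec, h3, mulVec_zero]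
    rwa [hSΔ, Matrix.mul_assoc, ← hsymm, sub_mulVec, sub_mulVec, h5, h6, sub_zero, sub_zero] at h2
  apply hker
  · rw [hG, ← mulVec_mulVec, ← hy, ← mulVec_mulVec, h3, mulVec_zero]
  · have h5 : Lᵀ *ᵥ (M *ᵥ x) = 0 := by
      rw [mulVec_mulVec, ← hNM, ← mulVec_mulVec, ← hy, h4]
    have h6 := congrArg (fun v => Lᵀ⁻¹ *ᵥ v) h5
    simpa only [mulVec_mulVec, ← Matrix.mul_assoc, nonsing_inv_mul _ hLt, Matrix.one_mul,
      mulVec_zero] using h6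

/-- For `M = 1 - Tᴴ Γ` the matrix `Γᴴ M` is hermitian, hence symmetric after `ρ`, and `Γ x = 0`
forces `M x = x`; so `(M, Γ)` reduces to a Lagrangian. A transversal symmetric matrix lifts to a
hermitian one, and adding it to `T` does not change `T - Tᴴ`. -/
theorem exists_map_det_one_sub_ne_zero {R k n : Type*} [CommRing R] [StarRing R] [Field k]
    [Fintype n] [DecidableEq n] {ρ : R →+* k} (hρ : ∀ x, ρ (star x) = ρ x)
    (hsurj : ∀ y, ∃ a, star a = a ∧ ρ a = y) {T Γ : Matrix n n R}
    (h : Γ = Γᴴ + Γᴴ * (T - Tᴴ) * Γ) :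
    ∃ T' : Matrix n n R, T' - T'ᴴ = T - Tᴴ ∧ ρ (1 - T'ᴴ * Γ).det ≠ 0 := by
  have hct : ∀ A : Matrix n n R, ρ.mapMatrix Aᴴ = (ρ.mapMatrix A)ᵀ := fun A => by
    ext i j; simp [hρ]
  set M := 1 - Tᴴ * Γ with hM
  have hX : (Γᴴ * M)ᴴ = Γᴴ * M := by
    rw [hM]
    simp only [conjTranspose_sub, conjTranspose_one, conjTranspose_mul, conjTranspose_conjTranspose]
    have h1 : Γ - Γᴴ - (Γᴴ * T * Γ - Γᴴ * Tᴴ * Γ) = 0 := by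
      rw [sub_eq_zero, sub_eq_iff_eq_add]
      refine h.trans ?_
      noncomm_ring
    rw [← sub_eq_zero, ← h1]
    noncomm_ring
  obtain ⟨S, hS, hdet⟩ := exists_isSymm_det_sub_mul_ne_zero (M := ρ.mapMatrix M)
    (G := ρ.mapMatrix Γ) (by
      rw [← hct, ← map_mul, IsSymm, ← hct, hX]) (fun x hx hx' => by
      rw [hM, map_sub, map_one, map_mul, sub_mulVec, ← mulVec_mulVec, hx, mulVec_zero, one_mulVec,
        sub_zero] at hx'
      exact hx')
  choose a ha ha' using hsurj
  set S' : Matrix n n R := S.map a with hS'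
  have hS'1 : S'ᴴ = S' := by
    ext i j
    simp only [hS', conjTranspose_apply, map_apply, ha]
    rw [← hS.apply]
  have hS'2 : ρ.mapMatrix S' = S := by
    ext i j; simp [hS', ha']
  refine ⟨T + S', ?_, ?_⟩
  · rw [conjTranspose_add, hS'1]; abel
  · rw [conjTranspose_add, hS'1, RingHom.map_det]
    rwa [Matrix.add_mul, ← sub_sub, map_sub, map_mul, hS'2]

end EvenForms

/-! ### The maximal order of a local field is a discrete valuation ring -/

section LocalField

variable (p : ℕ) [Fact p.Prime] (K : Type*) [Field K] [Algebra ℚ_[p] K] [FiniteDimensional ℚ_[p] K]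
  [Algebra ℤ_[p] K] [IsScalarTower ℤ_[p] ℚ_[p] K]

instance isFractionRing_maxOrder : IsFractionRing (maxOrder p K) K :=
  integralClosure.isFractionRing_of_finite_extension ℚ_[p] K

instance isDedekindDomain_maxOrder : IsDedekindDomain (maxOrder p K) :=
  integralClosure.isDedekindDomain ℤ_[p] ℚ_[p] K

variable {p K}

theorem mem_maxOrder_of_spectralNorm_le_one {x : K} (hx : spectralNorm ℚ_[p] K x ≤ 1) :
    x ∈ maxOrder p K := by
  have hint : IsIntegral ℚ_[p] x := Algebra.IsIntegral.isIntegral x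
  have h := (spectralValue_le_one_iff (minpoly.monic hint)).1 hx
  have hl : minpoly ℚ_[p] x ∈ Polynomial.lifts (algebraMap ℤ_[p] ℚ_[p]) := by
    rw [Polynomial.lifts_iff_coeff_lifts]
    exact fun n => ⟨⟨_, h n⟩, rfl⟩
  obtain ⟨q, hq, -, hm⟩ := Polynomial.lifts_and_degree_eq_and_monic hl (minpoly.monic hint)
  refine ⟨q, hm, ?_⟩
  rw [IsScalarTower.algebraMap_eq ℤ_[p] ℚ_[p] K, ← Polynomial.eval₂_map, hq]
  exact minpoly.aeval _ x

/-- The spectral norm is multiplicative, so `x` and `x⁻¹` cannot both have norm greater than 1. -/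
theorem mem_maxOrder_or_inv_mem (x : K) : x ∈ maxOrder p K ∨ x⁻¹ ∈ maxOrder p K := by
  by_cases h0 : x = 0
  · exact Or.inl (h0 ▸ zero_mem _)
  by_contra! h
  have h1 := not_le.1 (mt mem_maxOrder_of_spectralNorm_le_one h.1)
  have h2 := not_le.1 (mt mem_maxOrder_of_spectralNorm_le_one h.2)
  have h3 : spectralNorm ℚ_[p] K (x * x⁻¹) = spectralNorm ℚ_[p] K x * spectralNorm ℚ_[p] K x⁻¹ :=
    spectralAlgNorm_mul x x⁻¹
  rw [mul_inv_cancel₀ h0, spectralNorm_one] at h3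
  nlinarith

theorem inv_natCast_notMem_maxOrder : (p : K)⁻¹ ∉ maxOrder p K := by
  intro h
  have h1 : IsIntegral ℤ_[p] ((p : ℚ_[p])⁻¹) := by
    rw [← isIntegral_algebraMap_iff (algebraMap ℚ_[p] K).injective]
    simpa using (mem_integralClosure_iff ℤ_[p] K).1 h
  obtain ⟨y, hy⟩ := IsIntegrallyClosed.isIntegral_iff.1 h1
  have h2 : ‖(p : ℚ_[p])⁻¹‖ ≤ 1 := hy ▸ y.2
  rw [norm_inv, Padic.norm_p, inv_inv] at h2
  have := (Fact.out : p.Prime).one_lt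
  norm_cast at h2
  omega

variable (p K) in
theorem not_isField_maxOrder : ¬ IsField (maxOrder p K) := by
  intro h
  have hp0 : (p : maxOrder p K) ≠ 0 := by
    have : CharZero K := charZero_of_injective_algebraMap (algebraMap ℚ_[p] K).injective
    intro h0
    have := congrArg Subtype.val h0
    simp at this
    exact (Fact.out : p.Prime).ne_zero this
  obtain ⟨y, hy⟩ := h.mul_inv_cancel hp0
  have h1 : (p : K) * y = 1 := by simpa using congrArg Subtype.val hy
  apply inv_natCast_notMem_maxOrder (p := p) (K := K)
  rw [← eq_inv_of_mul_eq_one_right h1]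
  exact y.2

instance valuationRing_maxOrder : ValuationRing (maxOrder p K) := by
  rw [ValuationRing.iff_isInteger_or_isInteger _ K]
  intro x
  rcases mem_maxOrder_or_inv_mem (p := p) x with h | h
  · exact Or.inl ⟨⟨x, h⟩, rfl⟩
  · exact Or.inr ⟨⟨_, h⟩, rfl⟩

instance isDiscreteValuationRing_maxOrder : IsDiscreteValuationRing (maxOrder p K) :=
  ((IsDiscreteValuationRing.TFAE (maxOrder p K) (not_isField_maxOrder p K)).out 0 1).2
    (valuationRing_maxOrder (p := p) (K := K))

variable (p K) in
theorem exists_inverseDifferent_eq_span :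
    ∃ δ : K, δ ≠ 0 ∧ inverseDifferent p K = Submodule.span (maxOrder p K) {δ⁻¹} := by
  set J : FractionalIdeal (nonZeroDivisors (maxOrder p K)) K :=
    FractionalIdeal.dual ℤ_[p] ℚ_[p]
    (1 : FractionalIdeal (nonZeroDivisors (maxOrder p K)) K) with hJ
  have h1 : (1 : FractionalIdeal (nonZeroDivisors (maxOrder p K)) K) ≠ 0 := one_ne_zero
  have hJ0 : J ≠ 0 := FractionalIdeal.dual_ne_zero ℤ_[p] ℚ_[p] h1
  have hJp : (J : Submodule (maxOrder p K) K).IsPrincipal := inferInstance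
  obtain ⟨x, hx⟩ := hJp.principal
  have hJe : (J : Submodule (maxOrder p K) K) = inverseDifferent p K := by
    ext y
    rw [FractionalIdeal.mem_coe, FractionalIdeal.mem_dual h1]
    constructor
    · intro h z hz
      exact h z ((FractionalIdeal.mem_one_iff _).2 ⟨⟨z, hz⟩, rfl⟩)
    · intro h z hz
      obtain ⟨w, rfl⟩ := (FractionalIdeal.mem_one_iff _).1 hz
      exact h w w.2
  refine ⟨x⁻¹, fun h => hJ0 ?_, by rw [← hJe, hx, inv_inv]⟩
  rw [inv_eq_zero] at h
  rw [h, Submodule.span_singleton_eq_bot.2 rfl] at hx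
  exact FractionalIdeal.coeToSubmodule_eq_bot.1 hx

end LocalField

/-! ### Quadratic étale algebras: trace, norm and involution -/

section QuadraticAlgebra

variable {K E : Type*} [Field K] [CommRing E] [Algebra K E]

theorem exists_notMem_range_algebraMap (hE : Module.finrank K E = 2) :
    ∃ θ : E, θ ∉ (algebraMap K E).range := by
  by_contra! h
  have h1 : Module.finrank K E ≤ 1 := finrank_le_one (1 : E) fun w => by
    obtain ⟨c, rfl⟩ := h w
    exact ⟨c, by rw [Algebra.smul_def, mul_one]⟩
  omega

theorem eq_zero_of_add_mul_eq_zero [Nontrivial E] {θ : E} (hθ : θ ∉ (algebraMap K E).range)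
    {a b : K} (h : algebraMap K E a + algebraMap K E b * θ = 0) : a = 0 ∧ b = 0 := by
  have hb : b = 0 := by
    by_contra hb
    apply hθ
    refine ⟨-(b⁻¹ * a), ?_⟩
    have h1 : algebraMap K E b⁻¹ * algebraMap K E b = 1 := by
      rw [← map_mul, inv_mul_cancel₀ hb, map_one]
    rw [map_neg, map_mul]
    linear_combination θ * h1 - algebraMap K E b⁻¹ * h
  subst hb
  rw [map_zero, zero_mul, add_zero] at h
  exact ⟨(algebraMap K E).injective (by rw [h, map_zero]), rfl⟩

theorem exists_basis_one_gen (hE : Module.finrank K E = 2) {θ : E}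
    (hθ : θ ∉ (algebraMap K E).range) :
    ∃ b : Module.Basis (Fin 2) K E, b 0 = 1 ∧ b 1 = θ := by
  have : Nontrivial E := Module.nontrivial_of_finrank_pos (R := K) (by omega)
  have hli : LinearIndependent K ![1, θ] := by
    rw [LinearIndependent.pair_iff]
    intro s t hst
    rw [Algebra.smul_def, Algebra.smul_def, mul_one] at hst
    exact eq_zero_of_add_mul_eq_zero hθ hst
  refine ⟨basisOfLinearIndependentOfCardEqFinrank hli (by simp [hE]), ?_, ?_⟩ <;> simp

theorem exists_eq_add_mul (hE : Module.finrank K E = 2) {θ : E}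
    (hθ : θ ∉ (algebraMap K E).range) (x : E) :
    ∃ a b : K, x = algebraMap K E a + algebraMap K E b * θ := by
  obtain ⟨b, h0, h1⟩ := exists_basis_one_gen hE hθ
  refine ⟨b.repr x 0, b.repr x 1, ?_⟩
  conv_lhs => rw [← b.sum_repr x]
  rw [Fin.sum_univ_two, h0, h1, Algebra.smul_def, Algebra.smul_def, mul_one]

theorem trace_eq_of_sq_eq (hE : Module.finrank K E = 2) {θ : E}
    (hθ : θ ∉ (algebraMap K E).range) {t n : K}
    (h : θ * θ = algebraMap K E t * θ - algebraMap K E n) : Algebra.trace K E θ = t := by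
  obtain ⟨b, h0, h1⟩ := exists_basis_one_gen hE hθ
  rw [Algebra.trace_eq_matrix_trace b, Matrix.trace_fin_two, Algebra.leftMulMatrix_eq_repr_mul,
    Algebra.leftMulMatrix_eq_repr_mul, h0, h1, mul_one, h]
  have e1 : b.repr θ = Finsupp.single 1 1 := by rw [← h1, b.repr_self]
  have e2 : b.repr (1 : E) = Finsupp.single 0 1 := by rw [← h0, b.repr_self]
  have e3 : algebraMap K E t * θ - algebraMap K E n = t • θ - n • (1 : E) := by
    rw [Algebra.smul_def, Algebra.smul_def, mul_one]
  rw [e3, map_sub, map_smul, map_smul, e1, e2]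
  simp

/-- Write `σ θ = α + β θ`. Applying `σ` to the quadratic equation of `θ` and comparing coefficients
gives `(β² - 1) · disc = 0`. Here `disc = (2θ - t)²` is nonzero because `E` is reduced, and `β = 1`
would make `σ` trivial. -/
theorem exists_sq_eq_and_apply_eq [CharZero K] [IsReduced E] (hE : Module.finrank K E = 2)
    {σ : E ≃ₐ[K] E} (hσ : σ ≠ AlgEquiv.refl) {θ : E} (hθ : θ ∉ (algebraMap K E).range) :
    ∃ t n : K, θ * θ = algebraMap K E t * θ - algebraMap K E n ∧ σ θ = algebraMap K E t - θ ∧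
      t ^ 2 - 4 * n ≠ 0 := by
  have : Nontrivial E := Module.nontrivial_of_finrank_pos (R := K) (by omega)
  obtain ⟨n', t, hsq⟩ := exists_eq_add_mul hE hθ (θ * θ)
  obtain ⟨α, β, hs⟩ := exists_eq_add_mul hE hθ (σ θ)
  have hdisc : t ^ 2 + 4 * n' ≠ 0 := by
    intro h0
    have h1 : (2 * θ - algebraMap K E t) ^ 2 = 0 := by
      have := congrArg (algebraMap K E) h0
      simp only [map_add, map_mul, map_pow, map_zero, map_ofNat] at this
      linear_combination 4 * hsq + this
    have h2 := eq_zero_of_pow_eq_zero h1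
    have h3 : algebraMap K E (-t) + algebraMap K E 2 * θ = 0 := by
      rw [map_neg, map_ofNat]; linear_combination h2
    exact two_ne_zero (eq_zero_of_add_mul_eq_zero hθ h3).2
  have h1 : (σ θ) * (σ θ) = algebraMap K E n' + algebraMap K E t * σ θ := by
    rw [← map_mul, hsq]; simp
  have h2 : algebraMap K E (α ^ 2 + β ^ 2 * n' - t * α - n') +
      algebraMap K E (β * (2 * α + β * t - t)) * θ = 0 := by
    simp only [map_add, map_sub, map_mul, map_pow, map_ofNat]
    rw [hs] at h1
    linear_combination h1 - (algebraMap K E β) ^ 2 * hsq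
  obtain ⟨e1, e2⟩ := eq_zero_of_add_mul_eq_zero hθ h2
  have hβ : β ≠ 0 := by
    rintro rfl
    rw [map_zero, zero_mul, add_zero] at hs
    apply hθ
    refine ⟨α, σ.injective ?_⟩
    rw [hs, AlgEquiv.commutes]
  have e3 := (mul_eq_zero.1 e2).resolve_left hβ
  have e4 : (β - 1) * (β + 1) * (t ^ 2 + 4 * n') = 0 := by
    linear_combination 4 * e1 - (2 * α - β * t - t) * e3
  rcases mul_eq_zero.1 ((mul_eq_zero.1 e4).resolve_right hdisc) with hb | hb
  · exfalso
    have hb1 : β = 1 := by linear_combination hb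
    have ha0 : α = 0 := by
      have : 2 * α = 0 := by rw [hb1] at e3; linear_combination e3
      simpa using this
    apply hσ
    ext x
    obtain ⟨a, b, rfl⟩ := exists_eq_add_mul hE hθ x
    rw [map_add, map_mul, AlgEquiv.commutes, AlgEquiv.commutes, hs, hb1, ha0]
    simp
  · have hb1 : β = -1 := by linear_combination hb
    have ha0 : α = t := by
      have : 2 * (α - t) = 0 := by rw [hb1] at e3; linear_combination e3
      have := (mul_eq_zero.1 this).resolve_left two_ne_zero
      linear_combination this
    refine ⟨t, -n', ?_, ?_, ?_⟩
    · rw [hsq, map_neg]; ring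
    · rw [hs, hb1, ha0]; simp; ring
    · intro h; apply hdisc; linear_combination h

variable [CharZero K] [IsReduced E] (hE : Module.finrank K E = 2)
    {σ : E ≃ₐ[K] E} (hσ : σ ≠ AlgEquiv.refl)
include hE hσ

theorem algebraMap_trace_eq (x : E) : algebraMap K E (Algebra.trace K E x) = x + σ x := by
  by_cases hx : x ∈ (algebraMap K E).range
  · obtain ⟨c, rfl⟩ := hx
    rw [Algebra.trace_algebraMap, hE, AlgEquiv.commutes, two_nsmul, map_add]
  · obtain ⟨t, n, h1, h2, -⟩ := exists_sq_eq_and_apply_eq hE hσ hx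
    rw [trace_eq_of_sq_eq hE hx h1, h2]; ring

theorem apply_apply_eq_self (x : E) : σ (σ x) = x := by
  have h := algebraMap_trace_eq hE hσ x
  have h2 := congrArg σ h
  rw [AlgEquiv.commutes, map_add, h] at h2
  linear_combination -h2

theorem exists_algebraMap_eq_mul_apply (x : E) : ∃ c, algebraMap K E c = x * σ x := by
  by_cases hx : x ∈ (algebraMap K E).range
  · obtain ⟨c, rfl⟩ := hx
    exact ⟨c * c, by rw [AlgEquiv.commutes, map_mul]⟩
  · obtain ⟨t, n, h1, h2, -⟩ := exists_sq_eq_and_apply_eq hE hσ hx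
    exact ⟨n, by rw [h2]; linear_combination h1⟩

theorem exists_algebraMap_eq_of_apply_eq {x : E} (hx : σ x = x) : ∃ c, algebraMap K E c = x := by
  refine ⟨2⁻¹ * Algebra.trace K E x, ?_⟩
  have h2 : algebraMap K E 2⁻¹ * 2 = 1 := by
    rw [← map_ofNat (algebraMap K E) 2, ← map_mul, inv_mul_cancel₀ two_ne_zero, map_one]
  rw [map_mul, algebraMap_trace_eq hE hσ, hx]
  linear_combination x * h2

end QuadraticAlgebra

/-! ### Monogenicity of the quadratic maximal order -/

section QuadraticOrder

variable {p : ℕ} [Fact p.Prime] {K E : Type*} [Field K] [CommRing E] [Algebra K E]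
  [Algebra ℤ_[p] K] [Algebra ℤ_[p] E] [IsScalarTower ℤ_[p] K E]

theorem algebraMap_mem_maxOrder_iff [Nontrivial E] {c : K} :
    algebraMap K E c ∈ maxOrder p E ↔ c ∈ maxOrder p K := by
  rw [mem_integralClosure_iff, mem_integralClosure_iff,
    isIntegral_algebraMap_iff (algebraMap K E).injective]

theorem algebraMap_mem_maxOrder {c : K} (hc : c ∈ maxOrder p K) :
    algebraMap K E c ∈ maxOrder p E :=
  IsIntegral.algebraMap hc

theorem apply_mem_maxOrder (σ : E ≃ₐ[K] E) {x : E} (hx : x ∈ maxOrder p E) :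
    σ x ∈ maxOrder p E :=
  IsIntegral.map ((σ : E →ₐ[K] E).restrictScalars ℤ_[p]) hx

theorem mem_span_singleton_iff {A : Type*} [CommRing A] [Algebra ℤ_[p] A] {x y : A} :
    x ∈ Submodule.span (maxOrder p A) {y} ↔ ∃ c ∈ maxOrder p A, x = c * y := by
  rw [Submodule.mem_span_singleton]
  constructor
  · rintro ⟨c, rfl⟩; exact ⟨c, c.2, rfl⟩
  · rintro ⟨c, hc, rfl⟩; exact ⟨⟨c, hc⟩, rfl⟩

theorem mem_span_unit_iff {A : Type*} [CommRing A] [Algebra ℤ_[p] A] {x : A} {y : Aˣ} :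
    x ∈ Submodule.span (maxOrder p A) {(y : A)} ↔ x * ((y⁻¹ : Aˣ) : A) ∈ maxOrder p A := by
  rw [mem_span_singleton_iff]
  constructor
  · rintro ⟨c, hc, rfl⟩; rwa [Units.mul_inv_cancel_right]
  · intro h; exact ⟨_, h, by rw [Units.inv_mul_cancel_right]⟩

variable [Algebra ℚ_[p] K] [FiniteDimensional ℚ_[p] K] [IsScalarTower ℤ_[p] ℚ_[p] K]
  [CharZero K] [IsReduced E] (hE : Module.finrank K E = 2)
  {σ : E ≃ₐ[K] E} (hσ : σ ≠ AlgEquiv.refl)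

include hE hσ

theorem exists_integral_notMem_range :
    ∃ θ ∈ maxOrder p E, θ ∉ (algebraMap K E).range := by
  have : Nontrivial E := Module.nontrivial_of_finrank_pos (R := K) (by omega)
  obtain ⟨θ, hθ⟩ := exists_notMem_range_algebraMap hE
  obtain ⟨t, n, h1, -, -⟩ := exists_sq_eq_and_apply_eq hE hσ hθ
  have hint : ∀ z : K, ∃ y : maxOrder p K, y ≠ 0 ∧ (y : K) * z ∈ maxOrder p K := by
    intro z
    obtain ⟨⟨x, y⟩, hxy⟩ := IsLocalization.surj (nonZeroDivisors (maxOrder p K)) z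
    refine ⟨y, nonZeroDivisors.ne_zero y.2, ?_⟩
    have : ((y : maxOrder p K) : K) * z = x := by rw [mul_comm]; exact hxy
    rw [this]; exact x.2
  obtain ⟨y, hy0, hy⟩ := hint t
  obtain ⟨z, hz0, hz⟩ := hint n
  have hyz0 : ((y * z : maxOrder p K) : K) ≠ 0 := by
    simpa using mul_ne_zero hy0 hz0
  refine ⟨algebraMap K E (y * z : maxOrder p K) * θ, ?_, ?_⟩
  · set s := algebraMap K E (y * z : maxOrder p K) * θ with hs
    set t' : maxOrder p K := ⟨y * t, hy⟩ * z
    set n' : maxOrder p K := ⟨z * n, hz⟩ * (y * y * z)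
    have h2 : s * s = algebraMap K E (t' : K) * s - algebraMap K E (n' : K) := by
      simp only [s, t', n', MulMemClass.coe_mul, map_mul]
      linear_combination (algebraMap K E y * algebraMap K E z) ^ 2 * h1
    have h3 : IsIntegral (maxOrder p K) s := by
      refine ⟨Polynomial.X ^ 2 - Polynomial.C t' * Polynomial.X + Polynomial.C n',
        by monicity!, ?_⟩
      have e : ∀ r : maxOrder p K, algebraMap (maxOrder p K) E r = algebraMap K E r := fun r => rfl
      simp only [Polynomial.eval₂_add, Polynomial.eval₂_sub, Polynomial.eval₂_mul,
        Polynomial.eval₂_pow, Polynomial.eval₂_X, Polynomial.eval₂_C, e]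
      linear_combination h2
    exact isIntegral_trans (R := ℤ_[p]) (A := maxOrder p K) s h3
  · rintro ⟨c, hc⟩
    apply hθ
    refine ⟨((y * z : maxOrder p K) : K)⁻¹ * c, ?_⟩
    rw [map_mul, hc, ← mul_assoc, ← map_mul, inv_mul_cancel₀ hyz0, map_one, one_mul]

/-- The maximal order of a quadratic étale algebra is generated by one element. -/
theorem exists_maxOrder_gen :
    ∃ θ ∈ maxOrder p E, θ ∉ (algebraMap K E).range ∧
      ∀ x ∈ maxOrder p E, ∃ a ∈ maxOrder p K, ∃ b ∈ maxOrder p K,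
        x = algebraMap K E a + algebraMap K E b * θ := by
  have : Nontrivial E := Module.nontrivial_of_finrank_pos (R := K) (by omega)
  obtain ⟨θ, hθ, hθK⟩ := exists_integral_notMem_range (p := p) hE hσ
  obtain ⟨t, n, h1, h2, h3⟩ := exists_sq_eq_and_apply_eq hE hσ hθK
  have hdsq : (θ - σ θ) ^ 2 = algebraMap K E (t ^ 2 - 4 * n) := by
    simp only [map_sub, map_pow, map_mul, map_ofNat]
    rw [h2]; linear_combination 4 * h1
  set D := t ^ 2 - 4 * n with hD
  have hDo : D ∈ maxOrder p K := by
    rw [← algebraMap_mem_maxOrder_iff (E := E), ← hdsq]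
    exact pow_mem (sub_mem hθ (apply_mem_maxOrder σ hθ)) 2
  -- The `θ`-coefficients of integral elements form an `𝔬`-module whose denominators are bounded by
  -- the discriminant `D`. It is thus a principal fractional ideal, and an integral element whose
  -- coefficient is a generator of it is the required one.
  let J : Submodule (maxOrder p K) K :=
    { carrier := {b | ∃ a : K, algebraMap K E a + algebraMap K E b * θ ∈ maxOrder p E}
      zero_mem' := ⟨0, by simp⟩
      add_mem' := by
        rintro b b' ⟨a, h⟩ ⟨a', h'⟩
        refine ⟨a + a', ?_⟩
        convert add_mem h h' using 1
        rw [map_add, map_add]; ring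
      smul_mem' := by
        rintro c b ⟨a, h⟩
        refine ⟨c * a, ?_⟩
        convert mul_mem (algebraMap_mem_maxOrder (E := E) c.2) h using 1
        rw [Subalgebra.smul_def, smul_eq_mul, map_mul, map_mul]; ring }
  have hJD : ∀ b ∈ J, D * b ∈ maxOrder p K := by
    rintro b ⟨a, h⟩
    -- `b² D` is the square of `y - σ y` for the integral element `y = a + b θ`.
    have h4 : b ^ 2 * D ∈ maxOrder p K := by
      rw [← algebraMap_mem_maxOrder_iff (E := E), map_mul, ← hdsq, map_pow, ← mul_pow]
      refine pow_mem ?_ 2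
      convert sub_mem h (apply_mem_maxOrder σ h) using 1
      rw [map_add, map_mul, AlgEquiv.commutes, AlgEquiv.commutes]; ring
    have h5 : IsIntegral ℤ_[p] ((D * b) ^ 2) := by
      have := mul_mem hDo h4
      rwa [show D * (b ^ 2 * D) = (D * b) ^ 2 by ring] at this
    exact IsIntegral.of_pow (by norm_num) h5
  let J' : FractionalIdeal (nonZeroDivisors (maxOrder p K)) K :=
    ⟨J, ⟨D, hDo⟩, mem_nonZeroDivisors_of_ne_zero fun h => h3 (congrArg Subtype.val h),
      fun b hb => ⟨⟨_, hJD b hb⟩, rfl⟩⟩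
  have hJp : (J' : Submodule (maxOrder p K) K).IsPrincipal := inferInstance
  obtain ⟨β, hβ⟩ := hJp.principal
  have hβ' : J = Submodule.span (maxOrder p K) {β} := hβ
  obtain ⟨α, hα⟩ : β ∈ J := hβ' ▸ Submodule.mem_span_singleton_self β
  have hβ0 : β ≠ 0 := by
    rintro rfl
    have h1J : (1 : K) ∈ J := ⟨0, by simpa using hθ⟩
    rw [hβ', Submodule.span_singleton_eq_bot.2 rfl] at h1J
    exact one_ne_zero ((Submodule.mem_bot _).1 h1J)
  refine ⟨_, hα, ?_, fun x hx => ?_⟩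
  · rintro ⟨c, hc⟩
    apply hβ0
    refine (eq_zero_of_add_mul_eq_zero hθK (a := α - c) (b := β) ?_).2
    rw [map_sub, hc]; ring
  · obtain ⟨a, b, hab⟩ := exists_eq_add_mul hE hθK x
    have hb : b ∈ J := ⟨a, hab ▸ hx⟩
    rw [hβ', mem_span_singleton_iff] at hb
    obtain ⟨c, hc, rfl⟩ := hb
    have e : x = algebraMap K E (a - c * α) +
        algebraMap K E c * (algebraMap K E α + algebraMap K E β * θ) := by
      rw [hab, map_sub, map_mul, map_mul]; ring
    refine ⟨a - c * α, ?_, c, hc, e⟩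
    rw [← algebraMap_mem_maxOrder_iff (E := E)]
    have := sub_mem hx (mul_mem (algebraMap_mem_maxOrder (E := E) hc) hα)
    rwa [e, add_sub_cancel_right] at this

end QuadraticOrder

/-! ### Integral powers of principal fractional ideals -/

section PrincipalIdeals

variable {p : ℕ} [Fact p.Prime] {A : Type*} [CommRing A] [Algebra ℤ_[p] A]

theorem one_eq_span : (1 : Submodule (maxOrder p A) A) = Submodule.span (maxOrder p A) {1} :=
  Submodule.one_eq_span

theorem span_mul_span_singleton (x y : A) :
    Submodule.span (maxOrder p A) {x} * Submodule.span (maxOrder p A) {y} =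
      Submodule.span (maxOrder p A) {x * y} := by
  rw [Submodule.span_mul_span, Set.singleton_mul_singleton]

theorem one_div_span_unit (u : Aˣ) :
    (1 : Submodule (maxOrder p A) A) / Submodule.span (maxOrder p A) {(u : A)} =
      Submodule.span (maxOrder p A) {((u⁻¹ : Aˣ) : A)} := by
  ext x
  rw [Submodule.mem_div_iff_forall_mul_mem, mem_span_unit_iff, inv_inv]
  simp only [one_eq_span, mem_span_singleton_iff, mul_one, exists_eq_right']
  constructor
  · intro h
    exact h u ⟨1, one_mem _, (one_mul _).symm⟩
  · rintro h y ⟨c, hc, rfl⟩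
    convert mul_mem hc h using 1
    ring

theorem zpowIdeal_span_unit (u : Aˣ) (n : ℤ) :
    zpowIdeal (Submodule.span (maxOrder p A) {(u : A)}) n =
      Submodule.span (maxOrder p A) {((u ^ n : Aˣ) : A)} := by
  have hpow : ∀ m : ℕ, Submodule.span (maxOrder p A) {(u : A)} ^ m =
      Submodule.span (maxOrder p A) {((u ^ m : Aˣ) : A)} := by
    intro m
    rw [Submodule.span_pow, Set.singleton_pow, Units.val_pow_eq_pow_val]
  cases n with
  | ofNat m =>
    rw [zpowIdeal, hpow]
    simp
  | negSucc m =>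
    rw [zpowIdeal, hpow, one_div_span_unit, zpow_negSucc]

theorem span_zpow_eq_of_span_eq {u v : Aˣ}
    (h : Submodule.span (maxOrder p A) {(u : A)} = Submodule.span (maxOrder p A) {(v : A)})
    (n : ℤ) : Submodule.span (maxOrder p A) {((u ^ n : Aˣ) : A)} =
      Submodule.span (maxOrder p A) {((v ^ n : Aˣ) : A)} := by
  rw [← zpowIdeal_span_unit, ← zpowIdeal_span_unit, h]

end PrincipalIdeals

theorem extendIdeal_span {p : ℕ} [Fact p.Prime] {K E : Type*} [Field K] [CommRing E] [Algebra K E]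
    [Algebra ℤ_[p] K] [Algebra ℤ_[p] E] [IsScalarTower ℤ_[p] K E] (x : K) :
    extendIdeal p E (Submodule.span (maxOrder p K) {x}) =
      Submodule.span (maxOrder p E) {algebraMap K E x} := by
  apply le_antisymm
  · rw [extendIdeal, Submodule.span_le]
    rintro _ ⟨y, hy, rfl⟩
    obtain ⟨c, hc, rfl⟩ := mem_span_singleton_iff.1 hy
    exact mem_span_singleton_iff.2 ⟨_, algebraMap_mem_maxOrder hc, map_mul _ _ _⟩
  · rw [Submodule.span_singleton_le_iff_mem]
    exact Submodule.subset_span ⟨x, Submodule.mem_span_singleton_self x, rfl⟩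

/-- `θ` is integral and generates the maximal order of `E` over that of `K`. -/
structure IsMaxOrderGen (p : ℕ) [Fact p.Prime] (K : Type*) {E : Type*} [Field K] [CommRing E]
    [Algebra K E] [Algebra ℤ_[p] K] [Algebra ℤ_[p] E] (θ : E) : Prop where
  mem : θ ∈ maxOrder p E
  notMem_range : θ ∉ (algebraMap K E).range
  exists_eq : ∀ x ∈ maxOrder p E, ∃ a ∈ maxOrder p K, ∃ b ∈ maxOrder p K,
    x = algebraMap K E a + algebraMap K E b * θ

/-! ### The different of `E` in terms of a generator of the maximal order -/

section Different

variable {p : ℕ} [Fact p.Prime] {K E : Type*} [Field K] [CommRing E] [Algebra K E]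
  [Algebra ℤ_[p] K] [Algebra ℤ_[p] E] [IsScalarTower ℤ_[p] K E]
  [CharZero K] [IsReduced E] (hE : Module.finrank K E = 2)
  {σ : E ≃ₐ[K] E} (hσ : σ ≠ AlgEquiv.refl) {θ : E}

theorem IsMaxOrderGen.exists_sub_apply_eq (hθ : IsMaxOrderGen p K θ) (σ : E ≃ₐ[K] E) {y : E}
    (hy : y ∈ maxOrder p E) : ∃ b ∈ maxOrder p K, y - σ y = algebraMap K E b * (θ - σ θ) := by
  obtain ⟨a, -, b, hb, rfl⟩ := hθ.exists_eq y hy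
  refine ⟨b, hb, ?_⟩
  rw [map_add, map_mul, AlgEquiv.commutes, AlgEquiv.commutes]; ring

include hE hσ

theorem IsMaxOrderGen.exists_units_eq_sub_apply (hθ : IsMaxOrderGen p K θ) :
    ∃ d : Eˣ, (d : E) = θ - σ θ ∧ σ d = -d := by
  have : Nontrivial E := Module.nontrivial_of_finrank_pos (R := K) (by omega)
  obtain ⟨t, n, h1, h2, h3⟩ := exists_sq_eq_and_apply_eq hE hσ hθ.notMem_range
  have hdsq : (θ - σ θ) * (θ - σ θ) = algebraMap K E (t ^ 2 - 4 * n) := by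
    simp only [map_sub, map_pow, map_mul, map_ofNat]
    rw [h2]; linear_combination 4 * h1
  have hu : IsUnit (θ - σ θ) := by
    have : IsUnit ((θ - σ θ) * (θ - σ θ)) := by
      rw [hdsq]; exact (IsUnit.mk0 _ h3).map (algebraMap K E)
    exact isUnit_of_mul_isUnit_left this
  refine ⟨hu.unit, rfl, ?_⟩
  rw [IsUnit.unit_spec, map_sub, apply_apply_eq_self hE hσ]; ring

/-- The relative different is generated by `d = θ - σ θ`. One direction is `Tr(x θ) - Tr(x) σ θ = x
d`; the other is `Tr(x y) d = x d y - σ (x d y)`, which holds as `σ d = -d`, together with `w - σ w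
∈ 𝔬 d` for integral `w`. -/
theorem IsMaxOrderGen.forall_trace_mul_mem_iff (hθ : IsMaxOrderGen p K θ) {x : E} :
    (∀ y ∈ maxOrder p E, Algebra.trace K E (x * y) ∈ maxOrder p K) ↔
      x * (θ - σ θ) ∈ maxOrder p E := by
  have : Nontrivial E := Module.nontrivial_of_finrank_pos (R := K) (by omega)
  constructor
  · intro h
    have h1 := algebraMap_mem_maxOrder (E := E) (h 1 (one_mem _))
    have h2 := algebraMap_mem_maxOrder (E := E) (h θ hθ.mem)
    rw [algebraMap_trace_eq hE hσ] at h1 h2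
    convert sub_mem h2 (mul_mem h1 (apply_mem_maxOrder σ hθ.mem)) using 1
    simp only [map_mul, map_one]; ring
  · intro h y hy
    obtain ⟨d, hd, hσd⟩ := hθ.exists_units_eq_sub_apply hE hσ
    obtain ⟨b, hb, hb'⟩ := hθ.exists_sub_apply_eq σ (mul_mem h hy)
    have e : algebraMap K E (Algebra.trace K E (x * y)) = algebraMap K E b := by
      rw [algebraMap_trace_eq hE hσ]
      apply d.isUnit.mul_right_cancel
      rw [← hd] at hb'
      rw [← hb']
      simp only [map_mul, hσd]
      ring
    rwa [(algebraMap K E).injective e]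

variable [Algebra ℚ_[p] K] [FiniteDimensional ℚ_[p] K] [IsScalarTower ℤ_[p] ℚ_[p] K]
  [Algebra ℚ_[p] E] [IsScalarTower ℚ_[p] K E]

/-- Transitivity of the different in the tower `E/K/ℚ_p`. -/
theorem IsMaxOrderGen.mem_inverseDifferent_iff (hθ : IsMaxOrderGen p K θ) {δ : K} (hδ : δ ≠ 0)
    (hK : inverseDifferent p K = Submodule.span (maxOrder p K) {δ⁻¹}) {x : E} :
    x ∈ inverseDifferent p E ↔ x * (algebraMap K E δ * (θ - σ θ)) ∈ maxOrder p E := by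
  have : Nontrivial E := Module.nontrivial_of_finrank_pos (R := K) (by omega)
  have hfin : FiniteDimensional K E := Module.finite_of_finrank_pos (by omega)
  have hmem : ∀ c : K, c ∈ inverseDifferent p K ↔ c * δ ∈ maxOrder p K := by
    intro c
    rw [hK]
    simpa using mem_span_unit_iff (p := p) (x := c) (y := (Units.mk0 δ hδ)⁻¹)
  have h1 : x ∈ inverseDifferent p E ↔
      ∀ y ∈ maxOrder p E, Algebra.trace K E (x * y) ∈ inverseDifferent p K := by
    constructor
    · intro h y hy c hc
      have := h _ (mul_mem hy (algebraMap_mem_maxOrder (E := E) hc))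
      rwa [← Algebra.trace_trace (S := K), ← mul_assoc, mul_comm _ (algebraMap K E c),
        ← Algebra.smul_def, map_smul, smul_eq_mul, mul_comm c] at this
    · intro h y hy
      have := h y hy 1 (one_mem _)
      rwa [mul_one, Algebra.trace_trace] at this
  rw [h1, ← mul_assoc, ← hθ.forall_trace_mul_mem_iff hE hσ]
  refine forall₂_congr fun y _ => ?_
  rw [hmem, mul_assoc, mul_comm (algebraMap K E δ), ← mul_assoc, mul_comm _ (algebraMap K E δ),
    ← Algebra.smul_def, map_smul, smul_eq_mul, mul_comm δ]

theorem IsMaxOrderGen.different_eq (hθ : IsMaxOrderGen p K θ) {δ : K} (hδ : δ ≠ 0)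
    (hK : inverseDifferent p K = Submodule.span (maxOrder p K) {δ⁻¹}) :
    different p E = Submodule.span (maxOrder p E) {algebraMap K E δ * (θ - σ θ)} := by
  obtain ⟨d, hd, -⟩ := hθ.exists_units_eq_sub_apply hE hσ
  have h1 : inverseDifferent p E = Submodule.span (maxOrder p E)
      {(((Units.map (algebraMap K E).toMonoidHom (Units.mk0 δ hδ) * d)⁻¹ : Eˣ) : E)} := by
    ext x
    rw [mem_span_unit_iff, inv_inv, hθ.mem_inverseDifferent_iff hE hσ hδ hK, ← hd]
    rfl
  rw [different, h1, one_div_span_unit, inv_inv, ← hd]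
  rfl

end Different

/-! ### Uniformizers and the maximal ideal -/

section Uniformizer

/-- `π` generates the maximal ideal of the valuation ring of the local field `K`. -/
structure IsUniformizer (p : ℕ) [Fact p.Prime] {K : Type*} [Field K] [Algebra ℤ_[p] K]
    (π : Kˣ) : Prop where
  mem : (π : K) ∈ maxOrder p K
  inv_notMem : (π : K)⁻¹ ∉ maxOrder p K
  exists_eq_mul : ∀ x ∈ maxOrder p K, x⁻¹ ∉ maxOrder p K → ∃ y ∈ maxOrder p K, x = y * π
  exists_eq_mul_zpow : ∀ x : K, x ≠ 0 → ∃ u ∈ maxOrder p K, u⁻¹ ∈ maxOrder p K ∧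
    ∃ n : ℤ, x = u * ((π ^ n : Kˣ) : K)

variable (p : ℕ) [Fact p.Prime] (K : Type*) [Field K] [Algebra ℤ_[p] K]

theorem exists_isUniformizer [Algebra ℚ_[p] K] [FiniteDimensional ℚ_[p] K]
    [IsScalarTower ℤ_[p] ℚ_[p] K] : ∃ π : Kˣ, IsUniformizer p π := by
  obtain ⟨ϖ, hϖ⟩ := IsDiscreteValuationRing.exists_irreducible (maxOrder p K)
  have hϖ0 : (ϖ : K) ≠ 0 := fun h => hϖ.ne_zero (Subtype.ext h)
  have hint : ∀ x : maxOrder p K, x ≠ 0 → ∃ u ∈ maxOrder p K, u⁻¹ ∈ maxOrder p K ∧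
      ∃ n : ℕ, (x : K) = u * (ϖ : K) ^ n := by
    intro x hx
    obtain ⟨n, u, hu⟩ := IsDiscreteValuationRing.eq_unit_mul_pow_irreducible hx hϖ
    refine ⟨(u : maxOrder p K), (u : maxOrder p K).2, ?_, n, ?_⟩
    · have h1 : ((u : maxOrder p K) : K) * ((u⁻¹ : (maxOrder p K)ˣ) : maxOrder p K) = 1 := by
        exact congrArg (Subtype.val) (Units.mul_inv u)
      rw [← eq_inv_of_mul_eq_one_right h1]
      exact ((u⁻¹ : (maxOrder p K)ˣ) : maxOrder p K).2
    · have := congrArg (Subtype.val) hu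
      simpa using this
  refine ⟨Units.mk0 (ϖ : K) hϖ0, ϖ.2, fun h => ?_, fun x hx hx' => ?_, fun x hx => ?_⟩
  · apply hϖ.not_isUnit
    exact IsUnit.of_mul_eq_one ⟨_, h⟩ (Subtype.ext (mul_inv_cancel₀ hϖ0))
  · have hx0 : x ≠ 0 := by rintro rfl; exact hx' (by simp)
    obtain ⟨u, hu, hu', n, hn⟩ := hint ⟨x, hx⟩ (fun h => hx0 (congrArg Subtype.val h))
    cases n with
    | zero =>
      exfalso; apply hx'
      simp only [pow_zero, mul_one] at hn
      rwa [hn]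
    | succ n =>
      refine ⟨u * ϖ ^ n, mul_mem hu (pow_mem ϖ.2 n), ?_⟩
      rw [show x = u * (ϖ : K) ^ (n + 1) from hn, Units.val_mk0, pow_succ]; ring
  · rcases mem_maxOrder_or_inv_mem (p := p) x with h | h
    · obtain ⟨u, hu, hu', n, hn⟩ := hint ⟨x, h⟩ (fun h => hx (congrArg Subtype.val h))
      exact ⟨u, hu, hu', n, by simpa using hn⟩
    · obtain ⟨u, hu, hu', n, hn⟩ := hint ⟨x⁻¹, h⟩
        (fun h => inv_ne_zero hx (congrArg Subtype.val h))
      refine ⟨u⁻¹, hu', by rwa [inv_inv], -n, ?_⟩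
      rw [← inv_inv x, show x⁻¹ = u * (ϖ : K) ^ n from hn, mul_inv]
      simp

variable {p K} {π : Kˣ} (hπ : IsUniformizer p π)

theorem notMem_inv_of_lt_one {I : Submodule (maxOrder p K) K} (hI : I < 1) {x : K} (hx : x ∈ I)
    (hx0 : x ≠ 0) : x ∈ maxOrder p K ∧ x⁻¹ ∉ maxOrder p K := by
  have h1 : ∀ y, y ∈ (1 : Submodule (maxOrder p K) K) ↔ y ∈ maxOrder p K := fun y => by
    simp [one_eq_span, mem_span_singleton_iff]
  refine ⟨(h1 x).1 (hI.le hx), fun h => hI.not_ge fun y hy => ?_⟩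
  have h2 := I.smul_mem (⟨y * x⁻¹, mul_mem ((h1 y).1 hy) h⟩ : maxOrder p K) hx
  rwa [Subalgebra.smul_def, smul_eq_mul, inv_mul_cancel_right₀ hx0] at h2

include hπ

theorem IsUniformizer.le_span_of_lt_one {I : Submodule (maxOrder p K) K} (hI : I < 1) :
    I ≤ Submodule.span (maxOrder p K) {(π : K)} := by
  intro x hx
  by_cases hx0 : x = 0
  · rw [hx0]; exact zero_mem _
  · obtain ⟨h1, h2⟩ := notMem_inv_of_lt_one hI hx hx0
    exact mem_span_singleton_iff.2 (hπ.exists_eq_mul x h1 h2)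

theorem IsUniformizer.span_lt_one : Submodule.span (maxOrder p K) {(π : K)} < 1 := by
  rw [one_eq_span]
  refine lt_of_le_of_ne ?_ fun h => hπ.inv_notMem ?_
  · rw [Submodule.span_singleton_le_iff_mem, mem_span_singleton_iff]
    exact ⟨π, hπ.mem, (mul_one _).symm⟩
  · have : (1 : K) ∈ Submodule.span (maxOrder p K) {(π : K)} := by
      rw [h]; exact Submodule.mem_span_singleton_self _
    rwa [mem_span_unit_iff, one_mul, Units.val_inv_eq_inv_val] at this

theorem IsUniformizer.maxIdeal_eq : maxIdeal p K = Submodule.span (maxOrder p K) {(π : K)} :=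
  le_antisymm (sSup_le fun _ hI => hπ.le_span_of_lt_one hI) (le_sSup hπ.span_lt_one)

end Uniformizer

/-! ### Quadratic field extensions: ramified residue fields and unramified norm-one units -/

section QuadraticField

universe u

variable {p : ℕ} [Fact p.Prime] {K : Type*} {E : Type u} [Field K] [Field E] [Algebra K E]
  [Algebra ℤ_[p] K] [Algebra ℤ_[p] E] [IsScalarTower ℤ_[p] K E]
  {ϖ : Eˣ} (hϖ : IsUniformizer p ϖ) {π : Kˣ} (hπ : IsUniformizer p π) (σ : E ≃ₐ[K] E)

include hϖ

theorem IsUniformizer.apply_mem_span (x : E)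
    (hx : x ∈ Submodule.span (maxOrder p E) {(ϖ : E)}) :
    σ x ∈ Submodule.span (maxOrder p E) {(ϖ : E)} := by
  obtain ⟨c, hc, rfl⟩ := mem_span_singleton_iff.1 hx
  rw [mem_span_singleton_iff]
  obtain ⟨y, hy, e⟩ := hϖ.exists_eq_mul (σ ϖ) (apply_mem_maxOrder σ hϖ.mem) fun h =>
    hϖ.inv_notMem (by simpa using apply_mem_maxOrder σ.symm h)
  exact ⟨σ c * y, mul_mem (apply_mem_maxOrder σ hc) hy, by rw [map_mul, e, mul_assoc]⟩

theorem IsUniformizer.invIdeal_eq :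
    invIdeal p σ = Submodule.span (maxOrder p E) {(ϖ : E)} :=
  le_antisymm (sSup_le fun _ hI => hϖ.le_span_of_lt_one hI.1)
    (le_sSup ⟨hϖ.span_lt_one, hϖ.apply_mem_span σ⟩)

include hπ

theorem IsUniformizer.exists_algebraMap_eq_mul :
    ∃ y ∈ maxOrder p E, algebraMap K E π = y * ϖ := by
  refine hϖ.exists_eq_mul _ (algebraMap_mem_maxOrder hπ.mem) fun h => hπ.inv_notMem ?_
  rwa [← map_inv₀, algebraMap_mem_maxOrder_iff] at h

theorem IsUniformizer.mem_span_of_algebraMap_mem_span {c : K}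
    (hc : algebraMap K E c ∈ Submodule.span (maxOrder p E) {(ϖ : E)}) :
    ∃ y ∈ maxOrder p K, c = y * π := by
  by_cases hc0 : c = 0
  · exact ⟨0, zero_mem _, by rw [hc0, zero_mul]⟩
  obtain ⟨h1, h2⟩ := notMem_inv_of_lt_one hϖ.span_lt_one hc
    (by simpa using hc0)
  rw [← map_inv₀, algebraMap_mem_maxOrder_iff] at h2
  exact hπ.exists_eq_mul c (algebraMap_mem_maxOrder_iff.1 h1) h2

variable (hne : Submodule.span (maxOrder p E) {algebraMap K E π} ≠
  Submodule.span (maxOrder p E) {(ϖ : E)})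
include hne

/-- The norm `ϖ σ(ϖ)` is `ϖ²` up to a unit and lies in `𝔭`, so `ϖ² ∈ π𝒪`. Conversely `π = y ϖ`,
where ramification prevents `y` from being a unit, so `ϖ` divides `y`. -/
theorem IsUniformizer.span_sq_eq_of_ramified [CharZero K] (hE : Module.finrank K E = 2)
    (hσ : σ ≠ AlgEquiv.refl) :
    Submodule.span (maxOrder p E) {((ϖ ^ 2 : Eˣ) : E)} =
      Submodule.span (maxOrder p E) {algebraMap K E π} := by
  have h0 : (ϖ : E) ≠ 0 := ϖ.ne_zero
  apply le_antisymm
  · rw [Submodule.span_singleton_le_iff_mem, mem_span_singleton_iff]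
    obtain ⟨N, hN⟩ := exists_algebraMap_eq_mul_apply hE hσ (ϖ : E)
    obtain ⟨v, hv, e⟩ := mem_span_singleton_iff.1
      (hϖ.apply_mem_span σ ϖ (Submodule.mem_span_singleton_self _))
    have hN' : algebraMap K E N ∈ Submodule.span (maxOrder p E) {(ϖ : E)} := by
      rw [hN, mul_comm]
      exact mem_span_singleton_iff.2 ⟨_, apply_mem_maxOrder σ hϖ.mem, rfl⟩
    obtain ⟨y, hy, rfl⟩ := hϖ.mem_span_of_algebraMap_mem_span hπ hN'
    have e1 : σ v * v = 1 := by
      have := congrArg σ e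
      rw [map_mul, apply_apply_eq_self hE hσ, e] at this
      apply mul_right_cancel₀ h0
      linear_combination -this
    refine ⟨σ v * algebraMap K E y, mul_mem (apply_mem_maxOrder σ hv)
      (algebraMap_mem_maxOrder hy), ?_⟩
    rw [map_mul, e] at hN
    rw [Units.val_pow_eq_pow_val]
    linear_combination (-(ϖ : E) ^ 2) * e1 - σ v * hN
  · rw [Submodule.span_singleton_le_iff_mem, mem_span_singleton_iff]
    obtain ⟨y, hy, e⟩ := hϖ.exists_algebraMap_eq_mul hπ
    have hy0 : y ≠ 0 := by
      rintro rfl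
      rw [zero_mul] at e
      simp at e
    obtain ⟨z, hz, rfl⟩ := hϖ.exists_eq_mul y hy fun h => hne <| by
      apply le_antisymm
      · rw [Submodule.span_singleton_le_iff_mem, mem_span_singleton_iff]
        exact ⟨y, hy, e⟩
      · rw [Submodule.span_singleton_le_iff_mem, mem_span_singleton_iff]
        exact ⟨_, h, by rw [e, inv_mul_cancel_left₀ hy0]⟩
    exact ⟨z, hz, by rw [e, Units.val_pow_eq_pow_val]; ring⟩

/-- Write `ϖ = a + b θ`. If `b` were in `𝔭`, then `a` would be too and `π` would divide `ϖ`,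
contrary to ramification. So `b` is a unit and `θ ≡ -a / b` modulo `ϖ`. -/
theorem IsUniformizer.exists_sub_algebraMap_mem_span {θ : E} (hθ : IsMaxOrderGen p K θ)
    {y : E} (hy : y ∈ maxOrder p E) :
    ∃ a ∈ maxOrder p K, y - algebraMap K E a ∈ Submodule.span (maxOrder p E) {(ϖ : E)} := by
  obtain ⟨a, ha, b, hb, e⟩ := hθ.exists_eq _ hϖ.mem
  obtain ⟨w, hw, hπϖ⟩ := hϖ.exists_algebraMap_eq_mul hπ
  have hb' : b⁻¹ ∈ maxOrder p K := by
    by_contra hbi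
    obtain ⟨b', hb', rfl⟩ := hπ.exists_eq_mul b hb hbi
    have h1 : algebraMap K E a ∈ Submodule.span (maxOrder p E) {(ϖ : E)} := by
      refine mem_span_singleton_iff.2 ⟨1 - algebraMap K E b' * w * θ, sub_mem (one_mem _)
        (mul_mem (mul_mem (algebraMap_mem_maxOrder hb') hw) hθ.mem), ?_⟩
      rw [map_mul] at e
      linear_combination -e - algebraMap K E b' * θ * hπϖ
    obtain ⟨a', ha', rfl⟩ := hϖ.mem_span_of_algebraMap_mem_span hπ h1
    apply hne
    apply le_antisymm
    · rw [Submodule.span_singleton_le_iff_mem, mem_span_singleton_iff]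
      exact ⟨w, hw, hπϖ⟩
    · rw [Submodule.span_singleton_le_iff_mem, mem_span_singleton_iff]
      refine ⟨algebraMap K E a' + algebraMap K E b' * θ, add_mem (algebraMap_mem_maxOrder ha')
        (mul_mem (algebraMap_mem_maxOrder hb') hθ.mem), ?_⟩
      rw [e, map_mul, map_mul]; ring
  -- Integrality of `b⁻¹` does not exclude `b = 0`, since `0⁻¹ = 0`; this case is ruled out
  -- separately.
  have hb0 : b ≠ 0 := by
    rintro rfl
    rw [map_zero, zero_mul, add_zero] at e
    have h1 : algebraMap K E a ∈ Submodule.span (maxOrder p E) {(ϖ : E)} := by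
      rw [← e]; exact Submodule.mem_span_singleton_self _
    obtain ⟨a', ha', rfl⟩ := hϖ.mem_span_of_algebraMap_mem_span hπ h1
    apply hne
    apply le_antisymm
    · rw [Submodule.span_singleton_le_iff_mem, mem_span_singleton_iff]
      exact ⟨w, hw, hπϖ⟩
    · rw [Submodule.span_singleton_le_iff_mem, mem_span_singleton_iff]
      exact ⟨_, algebraMap_mem_maxOrder ha', by rw [← map_mul, e]⟩
  obtain ⟨a₁, ha₁, b₁, hb₁, rfl⟩ := hθ.exists_eq y hy
  refine ⟨a₁ - b₁ * b⁻¹ * a, sub_mem ha₁ (mul_mem (mul_mem hb₁ hb') ha),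
    mem_span_singleton_iff.2 ⟨algebraMap K E (b₁ * b⁻¹),
      algebraMap_mem_maxOrder (mul_mem hb₁ hb'), ?_⟩⟩
  have h2 : algebraMap K E b⁻¹ * algebraMap K E b = 1 := by
    rw [← map_mul, inv_mul_cancel₀ hb0, map_one]
  rw [e]
  simp only [map_sub, map_mul]
  linear_combination (-algebraMap K E b₁ * θ) * h2

/-- In the ramified case the residue field of `E` is that of `K`, and `σ` acts trivially on it. -/
theorem IsUniformizer.exists_residue {θ : E} (hθ : IsMaxOrderGen p K θ)
    [Algebra ℚ_[p] E] [FiniteDimensional ℚ_[p] E] [IsScalarTower ℤ_[p] ℚ_[p] E] :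
    ∃ (k : Type u) (_ : Field k) (ρ : maxOrder p E →+* k), (∀ x, ρ x ≠ 0 → IsUnit x) ∧
      (∀ y, ∃ (a : K) (ha : a ∈ maxOrder p K),
        ρ ⟨algebraMap K E a, algebraMap_mem_maxOrder ha⟩ = y) ∧
      ∀ x : maxOrder p E, ρ ⟨σ x, apply_mem_maxOrder σ x.2⟩ = ρ x := by
  have hρ : ∀ x y : maxOrder p E, (x : E) - y ∈ Submodule.span (maxOrder p E) {(ϖ : E)} →
      IsLocalRing.residue (maxOrder p E) x = IsLocalRing.residue (maxOrder p E) y := by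
    intro x y h
    rw [← sub_eq_zero, ← map_sub, IsLocalRing.residue_eq_zero_iff, IsLocalRing.mem_maximalIdeal,
      mem_nonunits_iff]
    intro hu
    have h1 : (1 : E) ∈ Submodule.span (maxOrder p E) {(ϖ : E)} := by
      obtain ⟨v, hv⟩ := hu.exists_left_inv
      have h2 := Submodule.smul_mem _ v h
      rw [Subalgebra.smul_def, smul_eq_mul] at h2
      convert h2 using 1
      simpa using (congrArg Subtype.val hv).symm
    have := (notMem_inv_of_lt_one hϖ.span_lt_one h1 one_ne_zero).2
    rw [inv_one] at this
    exact this (one_mem _)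
  refine ⟨IsLocalRing.ResidueField (maxOrder p E), inferInstance,
    IsLocalRing.residue (maxOrder p E), fun x hx => ?_, fun y => ?_, fun x => ?_⟩
  · rwa [IsLocalRing.residue_ne_zero_iff_isUnit] at hx
  · obtain ⟨x, rfl⟩ := IsLocalRing.residue_surjective y
    obtain ⟨a, ha, h⟩ := hϖ.exists_sub_algebraMap_mem_span hπ hne hθ x.2
    exact ⟨a, ha, (hρ _ _ h).symm⟩
  · obtain ⟨a, ha, h⟩ := hϖ.exists_sub_algebraMap_mem_span hπ hne hθ x.2
    rw [hρ x ⟨algebraMap K E a, algebraMap_mem_maxOrder ha⟩ h]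
    apply hρ
    have := hϖ.apply_mem_span σ _ h
    rwa [map_sub, AlgEquiv.commutes] at this

omit hne hϖ hπ in
-- Hilbert 90: `u = z / σ z`. A uniformizer of `K` remains one in `E` and is fixed by `σ`, so its
-- power cancels from the quotient and `z` may be replaced by a unit `w`; then `u - 1 = (w - σ w) /
-- σ w`.
theorem IsUniformizer.sub_one_mem_span_of_unramified [CharZero K] (hE : Module.finrank K E = 2)
    {σ : E ≃ₐ[K] E} (hσ : σ ≠ AlgEquiv.refl) {θ : E} (hθ : IsMaxOrderGen p K θ)
    (hπ : IsUniformizer p (Units.map (algebraMap K E).toMonoidHom π)) {u : E} (hu1 : u * σ u = 1) :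
    u - 1 ∈ Submodule.span (maxOrder p E) {θ - σ θ} := by
  obtain ⟨d, hd, hσd⟩ := hθ.exists_units_eq_sub_apply hE hσ
  -- `z = 1 + u` works unless `u = -1`, when the anti-invariant element `d` does.
  obtain ⟨z, hz0, hz⟩ : ∃ z : E, z ≠ 0 ∧ u * σ z = z := by
    by_cases h : 1 + u = 0
    · exact ⟨d, d.ne_zero, by rw [hσd]; linear_combination -(d : E) * h⟩
    · exact ⟨1 + u, h, by rw [map_add, map_one]; linear_combination hu1⟩
  obtain ⟨w, hw, hw', n, rfl⟩ := hπ.exists_eq_mul_zpow z hz0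
  have hw0 : w ≠ 0 := by rintro rfl; simp at hz0
  have hww : u * σ w = w := by
    have e : σ (((Units.map (algebraMap K E).toMonoidHom π) ^ n : Eˣ) : E) =
        (((Units.map (algebraMap K E).toMonoidHom π) ^ n : Eˣ) : E) := by
      rw [← map_zpow]; exact AlgEquiv.commutes σ _
    rw [map_mul, e, ← mul_assoc] at hz
    exact mul_right_cancel₀ (Units.ne_zero _) hz
  obtain ⟨b, hb, e⟩ := hθ.exists_sub_apply_eq σ hw
  have hσw : σ w * σ w⁻¹ = 1 := by rw [← map_mul, mul_inv_cancel₀ hw0, map_one]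
  refine mem_span_singleton_iff.2 ⟨σ w⁻¹ * algebraMap K E b, mul_mem (apply_mem_maxOrder σ hw')
    (algebraMap_mem_maxOrder hb), ?_⟩
  rw [mul_assoc, ← e]
  linear_combination (1 - u) * hσw + σ w⁻¹ * hww

end QuadraticField

/-! ### Bases of lattices over fields -/

section LatticeBasis

/-- A finitely generated torsion-free module over the valuation ring of a local field is free. -/
theorem exists_linearIndependent_span_eq {p : ℕ} [Fact p.Prime] {K : Type*} [Field K]
    [Algebra ℚ_[p] K] [FiniteDimensional ℚ_[p] K] [Algebra ℤ_[p] K] [IsScalarTower ℤ_[p] ℚ_[p] K]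
    {W : Type*} [AddCommGroup W] [Module K W] {M : Submodule (maxOrder p K) W} (hM : M.FG) :
    ∃ (n : ℕ) (v : Fin n → W), LinearIndependent K v ∧
      Submodule.span (maxOrder p K) (Set.range v) = M := by
  have : Module.Finite (maxOrder p K) M := Module.Finite.iff_fg.2 hM
  have : Module.IsTorsionFree (maxOrder p K) W := by
    refine Module.IsTorsionFree.mk fun c hc x y hxy => ?_
    have hc0 : (c : K) ≠ 0 := fun h => hc.ne_zero (Subtype.ext h)
    exact smul_right_injective W hc0 hxy
  have : Module.Free (maxOrder p K) M := Module.free_of_finite_type_torsion_free'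
  let b := Module.finBasis (maxOrder p K) M
  refine ⟨_, fun i => (b i : W), ?_, ?_⟩
  · rw [← LinearIndependent.iff_fractionRing (R := maxOrder p K)]
    exact b.linearIndependent.map' M.subtype M.ker_subtype
  · have : Set.range (fun i => (b i : W)) = M.subtype '' Set.range b := by
      rw [← Set.range_comp]; rfl
    rw [this, Submodule.span_image, b.span_eq, Submodule.map_top, Submodule.range_subtype]

theorem exists_basis_span_eq_of_field {p : ℕ} [Fact p.Prime] {E : Type*} [Field E]
    [Algebra ℚ_[p] E] [FiniteDimensional ℚ_[p] E] [Algebra ℤ_[p] E] [IsScalarTower ℤ_[p] ℚ_[p] E]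
    {V : Type*} [AddCommGroup V] [Module E V] {L : Submodule (maxOrder p E) V} (hL : L.FG)
    (hs : Submodule.span E (L : Set V) = ⊤) :
    ∃ (n : ℕ) (b : Module.Basis (Fin n) E V),
      L = Submodule.span (maxOrder p E) (Set.range b) := by
  obtain ⟨n, v, hv, hvL⟩ := exists_linearIndependent_span_eq hL
  refine ⟨n, Module.Basis.mk hv ?_, by rw [Module.Basis.coe_mk, hvL]⟩
  rw [← hs, Submodule.span_le, ← hvL]
  exact Submodule.span_subset_span (maxOrder p E) E (Set.range v)

end LatticeBasis

/-! ### Split algebras and their idempotents -/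

section Split

variable {K E : Type*} [Field K] [CommRing E] [Algebra K E]
  [CharZero K] [IsReduced E] (hE : Module.finrank K E = 2)
  {σ : E ≃ₐ[K] E} (hσ : σ ≠ AlgEquiv.refl)

/-- A non-trivial idempotent of a split quadratic algebra. -/
structure IsSplitIdempotent (σ : E ≃ₐ[K] E) (e : E) : Prop where
  mul_self : e * e = e
  apply_eq : σ e = 1 - e
  notMem_range : e ∉ (algebraMap K E).range

theorem IsSplitIdempotent.one_sub {e : E} (he : IsSplitIdempotent σ e) :
    IsSplitIdempotent σ (1 - e) where
  mul_self := by linear_combination he.mul_self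
  apply_eq := by rw [map_sub, he.apply_eq, map_one]
  notMem_range := by
    rintro ⟨c, hc⟩
    exact he.notMem_range ⟨1 - c, by rw [map_sub, hc, map_one]; ring⟩

include hE

theorem IsSplitIdempotent.exists_eq {e : E} (he : IsSplitIdempotent σ e) (x : E) :
    ∃ a b : K, x = algebraMap K E a * e + algebraMap K E b * (1 - e) := by
  obtain ⟨a, b, h⟩ := exists_eq_add_mul hE he.notMem_range x
  exact ⟨a + b, a, by rw [h, map_add]; ring⟩

include hσ

/-- A nonzero non-unit `x` has norm 0, so `x² = t x` with `t` its trace. Reducedness forces `t ≠ 0`,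
and `x / t` is the idempotent. -/
theorem exists_isSplitIdempotent (hF : ¬ IsField E) : ∃ e, IsSplitIdempotent σ e := by
  have : Nontrivial E := Module.nontrivial_of_finrank_pos (R := K) (by omega)
  obtain ⟨x, hx0, hx⟩ : ∃ x : E, x ≠ 0 ∧ ¬ IsUnit x := by
    by_contra! h
    refine hF ⟨⟨0, 1, zero_ne_one⟩, mul_comm, fun {a} ha => ?_⟩
    obtain ⟨b, hb⟩ := (h a ha).exists_right_inv
    exact ⟨b, hb⟩
  obtain ⟨N, hN⟩ := exists_algebraMap_eq_mul_apply hE hσ x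
  have hN0 : N = 0 := by
    by_contra h
    have h1 : IsUnit (x * σ x) := hN ▸ (IsUnit.mk0 N h).map (algebraMap K E)
    exact hx (isUnit_of_mul_isUnit_left h1)
  rw [hN0, map_zero] at hN
  set t := Algebra.trace K E x with ht
  have htx : algebraMap K E t = x + σ x := algebraMap_trace_eq hE hσ x
  have ht0 : t ≠ 0 := by
    intro h
    rw [h, map_zero] at htx
    have : x ^ 2 = 0 := by linear_combination hN - x * htx
    exact hx0 (eq_zero_of_pow_eq_zero this)
  have hti : algebraMap K E t⁻¹ * algebraMap K E t = 1 := by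
    rw [← map_mul, inv_mul_cancel₀ ht0, map_one]
  refine ⟨algebraMap K E t⁻¹ * x, ?_, ?_, ?_⟩
  · linear_combination (-(algebraMap K E t⁻¹) ^ 2) * x * htx + algebraMap K E t⁻¹ * x * hti +
      (algebraMap K E t⁻¹) ^ 2 * hN
  · rw [map_mul, AlgEquiv.commutes, ← hti, htx]; ring
  · rintro ⟨c, hc⟩
    have h1 : x = algebraMap K E (t * c) := by
      rw [map_mul, hc]; linear_combination (-x) * hti
    have hc0 : t * c ≠ 0 := by rintro h; rw [h, map_zero] at h1; exact hx0 h1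
    exact hx (h1 ▸ (IsUnit.mk0 _ hc0).map (algebraMap K E))

end Split

/-! ### The maximal order and the ideal `𝔓` in the split case -/

section SplitOrder

variable {p : ℕ} [Fact p.Prime] {K E : Type*} [Field K] [CommRing E] [Algebra K E]
  [Algebra ℤ_[p] K] [Algebra ℤ_[p] E] [IsScalarTower ℤ_[p] K E]
  [CharZero K] [IsReduced E] {σ : E ≃ₐ[K] E} {e : E} (he : IsSplitIdempotent σ e)

include he

theorem IsSplitIdempotent.mem_maxOrder : e ∈ maxOrder p E := by
  refine ⟨Polynomial.X ^ 2 - Polynomial.X, by monicity!, ?_⟩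
  simp only [Polynomial.eval₂_sub, Polynomial.eval₂_pow, Polynomial.eval₂_X]
  linear_combination he.mul_self

theorem IsSplitIdempotent.mem_of_mul_mem [Nontrivial E] {a : K}
    (h : algebraMap K E a * e ∈ maxOrder p E) : a ∈ maxOrder p K := by
  rw [← algebraMap_mem_maxOrder_iff (E := E)]
  convert add_mem h (apply_mem_maxOrder σ h) using 1
  rw [map_mul, AlgEquiv.commutes, he.apply_eq]; ring

theorem IsSplitIdempotent.exists_eq_of_mem (hE : Module.finrank K E = 2) {x : E}
    (hx : x ∈ maxOrder p E) : ∃ a ∈ maxOrder p K, ∃ b ∈ maxOrder p K,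
      x = algebraMap K E a * e + algebraMap K E b * (1 - e) := by
  have : Nontrivial E := Module.nontrivial_of_finrank_pos (R := K) (by omega)
  obtain ⟨a, b, rfl⟩ := he.exists_eq hE x
  refine ⟨a, he.mem_of_mul_mem (p := p) ?_, b, he.one_sub.mem_of_mul_mem (p := p) ?_, rfl⟩
  · convert mul_mem hx he.mem_maxOrder using 1
    linear_combination (algebraMap K E b - algebraMap K E a) * he.mul_self
  · convert mul_mem hx he.one_sub.mem_maxOrder using 1
    linear_combination (algebraMap K E a - algebraMap K E b) * he.mul_self

/-- `d` is a unit: it divides `e - σ e = 2 e - 1`, whose square is 1. -/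
theorem IsSplitIdempotent.sub_one_mem_span {θ : E}
    (hθ : IsMaxOrderGen p K θ) {u : E} (hu : u ∈ maxOrder p E) :
    u - 1 ∈ Submodule.span (maxOrder p E) {θ - σ θ} := by
  obtain ⟨b, hb, h⟩ := hθ.exists_sub_apply_eq σ (he.mem_maxOrder (p := p))
  rw [he.apply_eq] at h
  refine mem_span_singleton_iff.2 ⟨(u - 1) * (e - (1 - e)) * algebraMap K E b,
    mul_mem (mul_mem (sub_mem hu (one_mem _)) (sub_mem he.mem_maxOrder
      (sub_mem (one_mem _) he.mem_maxOrder))) (algebraMap_mem_maxOrder hb), ?_⟩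
  linear_combination (u - 1) * (e - (1 - e)) * h - 4 * (u - 1) * he.mul_self

theorem IsSplitIdempotent.invIdeal_eq (hE : Module.finrank K E = 2) {π : Kˣ}
    (hπ : IsUniformizer p π) :
    invIdeal p σ = Submodule.span (maxOrder p E) {algebraMap K E π} := by
  have : Nontrivial E := Module.nontrivial_of_finrank_pos (R := K) (by omega)
  apply le_antisymm
  · refine sSup_le fun I hI x hx => ?_
    obtain ⟨hI1, hIσ⟩ := hI
    have hmemO : ∀ y ∈ I, y ∈ maxOrder p E := fun y hy => by
      have := hI1.le hy
      rw [one_eq_span, mem_span_singleton_iff] at this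
      obtain ⟨c, hc, rfl⟩ := this
      rwa [mul_one]
    have hmul : ∀ c ∈ maxOrder p E, ∀ y ∈ I, c * y ∈ I := fun c hc y hy =>
      I.smul_mem (⟨c, hc⟩ : maxOrder p E) hy
    -- Invariance is what matters here: if `a` were a unit, then `I` would contain `f` and `σ f = 1
    -- - f`, hence 1.
    have key : ∀ f : E, IsSplitIdempotent σ f → ∀ a ∈ maxOrder p K, algebraMap K E a * f ∈ I →
        ∃ a' ∈ maxOrder p K, a = a' * π := by
      intro f hf a ha haf
      by_cases ha0 : a = 0
      · exact ⟨0, zero_mem _, by rw [ha0, zero_mul]⟩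
      refine hπ.exists_eq_mul a ha fun hinv => hI1.not_ge fun y hy => ?_
      have h1 : f ∈ I := by
        have := hmul _ (algebraMap_mem_maxOrder (E := E) hinv) _ haf
        rwa [← mul_assoc, ← map_mul, inv_mul_cancel₀ ha0, map_one, one_mul] at this
      have h2 := add_mem h1 (hIσ f h1)
      rw [hf.apply_eq, add_sub_cancel] at h2
      rw [one_eq_span, mem_span_singleton_iff] at hy
      obtain ⟨c, hc, rfl⟩ := hy
      exact hmul c hc 1 h2
    obtain ⟨a, ha, b, hb, h⟩ := he.exists_eq_of_mem hE (hmemO x hx)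
    obtain ⟨a', ha', rfl⟩ := key e he a ha (by
      convert hmul e he.mem_maxOrder x hx using 1
      rw [h]; linear_combination (algebraMap K E b - algebraMap K E a) * he.mul_self)
    obtain ⟨b', hb', rfl⟩ := key (1 - e) he.one_sub b hb (by
      convert hmul (1 - e) he.one_sub.mem_maxOrder x hx using 1
      rw [h]; linear_combination (algebraMap K E (a' * π) - algebraMap K E b) * he.mul_self)
    refine mem_span_singleton_iff.2 ⟨algebraMap K E a' * e + algebraMap K E b' * (1 - e),
      add_mem (mul_mem (algebraMap_mem_maxOrder ha') he.mem_maxOrder)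
        (mul_mem (algebraMap_mem_maxOrder hb') he.one_sub.mem_maxOrder), ?_⟩
    rw [h, map_mul, map_mul]; ring
  · refine le_sSup ⟨?_, fun x hx => ?_⟩
    · rw [one_eq_span]
      refine lt_of_le_of_ne ?_ fun h => hπ.inv_notMem ?_
      · rw [Submodule.span_singleton_le_iff_mem, mem_span_singleton_iff]
        exact ⟨_, algebraMap_mem_maxOrder hπ.mem, (mul_one _).symm⟩
      · have h1 : (1 : E) ∈ Submodule.span (maxOrder p E) {algebraMap K E π} := by
          rw [h]; exact Submodule.mem_span_singleton_self _
        obtain ⟨c, hc, h2⟩ := mem_span_singleton_iff.1 h1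
        rw [← algebraMap_mem_maxOrder_iff (E := E)]
        convert hc using 1
        have h3 : algebraMap K E (π : K)⁻¹ * algebraMap K E π = 1 := by
          rw [← map_mul, inv_mul_cancel₀ π.ne_zero, map_one]
        linear_combination algebraMap K E (π : K)⁻¹ * h2 + c * h3
    · obtain ⟨c, hc, rfl⟩ := mem_span_singleton_iff.1 hx
      exact mem_span_singleton_iff.2 ⟨_, apply_mem_maxOrder σ hc, by
        rw [map_mul, AlgEquiv.commutes]⟩

end SplitOrder

/-! ### Freeness of hermitian lattices over a split algebra -/

section SplitLattice

variable {K E : Type*} [Field K] [CommRing E] [Algebra K E]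
  [CharZero K] [IsReduced E] (hE : Module.finrank K E = 2)
  {σ : E ≃ₐ[K] E} (hσ : σ ≠ AlgEquiv.refl)
  {V : Type*} [AddCommGroup V] [Module E V] [Module K V] [IsScalarTower K E V]

include hE hσ

theorem IsSplitIdempotent.mul_eq_zero_of_trace {e : E} (he : IsSplitIdempotent σ e) {x : E}
    (hx : Algebra.trace K E (e * x) = 0) : e * x = 0 := by
  obtain ⟨a, b, rfl⟩ := he.exists_eq hE x
  have h1 : e * (algebraMap K E a * e + algebraMap K E b * (1 - e)) = algebraMap K E a * e := by
    linear_combination (algebraMap K E a - algebraMap K E b) * he.mul_self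
  have h2 := algebraMap_trace_eq hE hσ (e * (algebraMap K E a * e + algebraMap K E b * (1 - e)))
  rw [hx, map_zero, h1, map_mul, AlgEquiv.commutes, he.apply_eq] at h2
  rw [h1]
  linear_combination (-e) * h2

/-- The two isotropic components of a hermitian space over a split algebra are paired
perfectly by the form. -/
theorem IsSplitIdempotent.rank_le {e : E} (he : IsSplitIdempotent σ e) (H : HermitianForm σ V)
    {S : Set V} (hS : Submodule.span E S = ⊤) {r s : ℕ} {v : Fin r → V} {w : Fin s → V}
    (hv : LinearIndependent K v) (hev : ∀ i, e • v i = v i)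
    (hw : ∀ x ∈ S, (1 - e) • x ∈ Submodule.span K (Set.range w)) : r ≤ s := by
  -- The trace makes the pairing `K`-valued without loss, being injective on `e E = K e`.
  -- Non-degeneracy then makes `f` injective on the span of `v`.
  let f : V →ₗ[K] (Fin s → K) := LinearMap.pi fun j =>
    { toFun := fun x => Algebra.trace K E (e * H.form x (w j))
      map_add' := fun x y => by rw [map_add, LinearMap.add_apply, mul_add, map_add]
      map_smul' := fun c x => by
        rw [← algebraMap_smul E c x, map_smul, LinearMap.smul_apply, smul_eq_mul,
          mul_left_comm, ← Algebra.smul_def, map_smul, RingHom.id_apply] }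
  have hf : Disjoint (Submodule.span K (Set.range v)) (LinearMap.ker f) := by
    rw [Submodule.disjoint_def]
    intro x hx hfx
    have hex : e • x = x := by
      clear hfx
      induction hx using Submodule.span_induction with
      | mem x hx => obtain ⟨i, rfl⟩ := hx; exact hev i
      | zero => rw [smul_zero]
      | add x y _ _ hx hy => rw [smul_add, hx, hy]
      | smul c x _ hx => rw [← algebraMap_smul E c x, smul_comm, hx]
    have heh : ∀ y, e * H.form x y = H.form x y := fun y => by
      conv_rhs => rw [← hex, map_smul, LinearMap.smul_apply, smul_eq_mul]
    have h0 : ∀ j, H.form x (w j) = 0 := fun j => by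
      rw [← heh]
      exact he.mul_eq_zero_of_trace hE hσ (congrFun (LinearMap.mem_ker.1 hfx) j)
    have h1 : ∀ y ∈ Submodule.span K (Set.range w), H.form x y = 0 := by
      intro y hy
      induction hy using Submodule.span_induction with
      | mem y hy => obtain ⟨i, rfl⟩ := hy; exact h0 i
      | zero => rw [map_zero]
      | add y z _ _ hy hz => rw [map_add, hy, hz, add_zero]
      | smul c y _ hy => rw [← algebraMap_smul E c y, LinearMap.map_smulₛₗ, hy, smul_zero]
    apply H.nondegenerate
    intro y
    have hy : y ∈ Submodule.span E S := hS ▸ Submodule.mem_top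
    induction hy using Submodule.span_induction with
    | mem y hy =>
      have := h1 _ (hw y hy)
      rw [LinearMap.map_smulₛₗ, smul_eq_mul] at this
      rw [← heh]
      convert this using 2
      simp [he.apply_eq]
    | zero => rw [map_zero]
    | add y z _ _ hy hz => rw [map_add, hy, hz, add_zero]
    | smul c y _ hy => rw [LinearMap.map_smulₛₗ, hy, smul_zero]
  simpa using (hv.map hf).fintype_card_le_finrank

/-- `e L` and `(1 - e) L` are free over `𝔬`, with bases `v` and `w`. The hermitian form pairs them,
so their ranks agree, and the vectors `v i + w i` form a basis of `L`. Without the form the ranks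
could differ and `L` need not be free. -/
theorem IsSplitIdempotent.exists_basis_span_eq {e : E} (he : IsSplitIdempotent σ e)
    {p : ℕ} [Fact p.Prime] [Algebra ℤ_[p] K] [Algebra ℤ_[p] E] [IsScalarTower ℤ_[p] K E]
    [Algebra ℚ_[p] K] [FiniteDimensional ℚ_[p] K] [IsScalarTower ℤ_[p] ℚ_[p] K]
    (H : HermitianForm σ V) {L : Submodule (maxOrder p E) V} (hL : L.FG)
    (hs : Submodule.span E (L : Set V) = ⊤) :
    ∃ (n : ℕ) (b : Module.Basis (Fin n) E V),
      L = Submodule.span (maxOrder p E) (Set.range b) := by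
  obtain ⟨S, rfl⟩ := hL
  have hS : Submodule.span E (S : Set V) = ⊤ := by
    rw [← hs]
    exact le_antisymm (Submodule.span_mono Submodule.subset_span)
      (Submodule.span_le.2 (Submodule.span_subset_span _ _ _))
  have hcomp : ∀ f : E, IsSplitIdempotent σ f → ∃ (n : ℕ) (v : Fin n → V),
      LinearIndependent K v ∧ Submodule.span (maxOrder p K) (Set.range v) =
        Submodule.span (maxOrder p K) ((fun x => f • x) '' (S : Set V)) := fun f _ =>
    exists_linearIndependent_span_eq (Submodule.fg_span (S.finite_toSet.image _))
  have hfix : ∀ f : E, IsSplitIdempotent σ f → ∀ x,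
      x ∈ Submodule.span (maxOrder p K) ((fun x => f • x) '' (S : Set V)) →
      f • x = x ∧ x ∈ Submodule.span (maxOrder p E) (S : Set V) := by
    intro f hf x hx
    induction hx using Submodule.span_induction with
    | mem x hx =>
      obtain ⟨y, hy, rfl⟩ := hx
      refine ⟨?_, ?_⟩
      · simp only [smul_smul, hf.mul_self]
      · exact Submodule.smul_mem _ (⟨f, hf.mem_maxOrder⟩ : maxOrder p E)
          (Submodule.subset_span hy)
    | zero => exact ⟨smul_zero _, zero_mem _⟩
    | add x y _ _ hx hy => exact ⟨by rw [smul_add, hx.1, hy.1], add_mem hx.2 hy.2⟩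
    | smul c x _ hx =>
      rw [Subalgebra.smul_def, ← algebraMap_smul E (c : K) x]
      refine ⟨by rw [smul_comm, hx.1], ?_⟩
      exact Submodule.smul_mem _
        (⟨algebraMap K E c, algebraMap_mem_maxOrder c.2⟩ : maxOrder p E) hx.2
  obtain ⟨r, v, hv, hvS⟩ := hcomp e he
  obtain ⟨s, w, hw, hwS⟩ := hcomp (1 - e) he.one_sub
  have hv1 : ∀ i, e • v i = v i ∧ v i ∈ Submodule.span (maxOrder p E) (S : Set V) := fun i =>
    hfix e he _ (hvS ▸ Submodule.subset_span ⟨i, rfl⟩)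
  have hw1 : ∀ i, (1 - e) • w i = w i ∧ w i ∈ Submodule.span (maxOrder p E) (S : Set V) :=
    fun i => hfix (1 - e) he.one_sub _ (hwS ▸ Submodule.subset_span ⟨i, rfl⟩)
  have hsub : ∀ x ∈ (S : Set V), e • x ∈ Submodule.span (maxOrder p K) (Set.range v) ∧
      (1 - e) • x ∈ Submodule.span (maxOrder p K) (Set.range w) := fun x hx =>
    ⟨hvS ▸ Submodule.subset_span ⟨x, hx, rfl⟩, hwS ▸ Submodule.subset_span ⟨x, hx, rfl⟩⟩
  obtain rfl : r = s := by
    apply le_antisymm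
    · exact he.rank_le hE hσ H hS hv (fun i => (hv1 i).1) fun x hx =>
        Submodule.span_subset_span (maxOrder p K) K _ (hsub x hx).2
    · refine he.one_sub.rank_le (w := v) hE hσ H hS hw (fun i => (hw1 i).1) fun x hx => ?_
      rw [sub_sub_cancel]
      exact Submodule.span_subset_span (maxOrder p K) K _ (hsub x hx).1
  have hez : ∀ i, e • (v i + w i) = v i := fun i => by
    rw [smul_add, (hv1 i).1, ← (hw1 i).1, smul_smul,
      show e * (1 - e) = 0 by linear_combination -he.mul_self, zero_smul, add_zero]
  have hez' : ∀ i, (1 - e) • (v i + w i) = w i := fun i => by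
    rw [sub_smul, one_smul, hez, add_sub_cancel_left]
  have hspan : Submodule.span (maxOrder p E) (Set.range fun i => v i + w i) =
      Submodule.span (maxOrder p E) (S : Set V) := by
    apply le_antisymm
    · rw [Submodule.span_le]
      rintro _ ⟨i, rfl⟩
      exact add_mem (hv1 i).2 (hw1 i).2
    · rw [Submodule.span_le]
      have hK : ∀ u : Fin r → V,
          (∀ i, u i ∈ Submodule.span (maxOrder p E) (Set.range fun i => v i + w i)) →
          ∀ x ∈ Submodule.span (maxOrder p K) (Set.range u),
            x ∈ Submodule.span (maxOrder p E) (Set.range fun i => v i + w i) := by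
        intro u hu x hx
        induction hx using Submodule.span_induction with
        | mem x hx => obtain ⟨i, rfl⟩ := hx; exact hu i
        | zero => exact zero_mem _
        | add x y _ _ hx hy => exact add_mem hx hy
        | smul c x _ hx =>
          rw [Subalgebra.smul_def, ← algebraMap_smul E (c : K) x]
          exact Submodule.smul_mem _
            (⟨algebraMap K E c, algebraMap_mem_maxOrder c.2⟩ : maxOrder p E) hx
      intro x hx
      have h1 := hK v (fun i => by
        rw [← hez i]
        exact Submodule.smul_mem _ (⟨e, he.mem_maxOrder⟩ : maxOrder p E)
          (Submodule.subset_span ⟨i, rfl⟩)) _ (hsub x hx).1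
      have h2 := hK w (fun i => by
        rw [← hez' i]
        exact Submodule.smul_mem _ (⟨1 - e, he.one_sub.mem_maxOrder⟩ : maxOrder p E)
          (Submodule.subset_span ⟨i, rfl⟩)) _ (hsub x hx).2
      have := add_mem h1 h2
      rwa [← add_smul, add_sub_cancel, one_smul] at this
  have hli : LinearIndependent E fun i => v i + w i := by
    rw [Fintype.linearIndependent_iff]
    intro g hg
    choose a b hab using fun i => he.exists_eq hE (g i)
    have h1 : ∑ i, a i • v i = 0 := by
      have := congrArg (fun x => e • x) hg
      simp only [Finset.smul_sum, smul_zero] at this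
      rw [← this]
      refine Finset.sum_congr rfl fun i _ => ?_
      rw [← algebraMap_smul E (a i) (v i), show algebraMap K E (a i) • v i =
        (algebraMap K E (a i) * e) • (v i + w i) by rw [mul_smul, hez], smul_smul, hab]
      congr 1
      linear_combination (algebraMap K E (b i) - algebraMap K E (a i)) * he.mul_self
    have h2 : ∑ i, b i • w i = 0 := by
      have := congrArg (fun x => (1 - e) • x) hg
      simp only [Finset.smul_sum, smul_zero] at this
      rw [← this]
      refine Finset.sum_congr rfl fun i _ => ?_
      rw [← algebraMap_smul E (b i) (w i), show algebraMap K E (b i) • w i =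
        (algebraMap K E (b i) * (1 - e)) • (v i + w i) by rw [mul_smul, hez'], smul_smul, hab]
      congr 1
      linear_combination (algebraMap K E (a i) - algebraMap K E (b i)) * he.mul_self
    intro i
    rw [hab, Fintype.linearIndependent_iff.1 hv a h1 i, Fintype.linearIndependent_iff.1 hw b h2 i]
    simp
  refine ⟨r, Module.Basis.mk hli ?_, by rw [Module.Basis.coe_mk, hspan]⟩
  rw [← hs, ← hspan, Submodule.span_le]
  exact Submodule.span_subset_span (maxOrder p E) E _

end SplitLattice

/-! ### Uniform statements for fields and split algebras -/

section Etale

universe u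

variable {p : ℕ} [Fact p.Prime] {K : Type*} {E : Type u} [Field K] [CommRing E] [Algebra K E]
  [Algebra ℤ_[p] K] [Algebra ℤ_[p] E] [IsScalarTower ℤ_[p] K E]
  [Algebra ℚ_[p] K] [FiniteDimensional ℚ_[p] K] [IsScalarTower ℤ_[p] ℚ_[p] K]
  [Algebra ℚ_[p] E] [IsScalarTower ℤ_[p] ℚ_[p] E] [IsScalarTower ℚ_[p] K E]
  [CharZero K] [IsReduced E] (hE : Module.finrank K E = 2)
  {σ : E ≃ₐ[K] E} (hσ : σ ≠ AlgEquiv.refl)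

theorem IsUniformizer.of_span_eq {A : Type*} [Field A] [Algebra ℤ_[p] A] {x y : Aˣ}
    (hx : IsUniformizer p x)
    (h : Submodule.span (maxOrder p A) {(x : A)} = Submodule.span (maxOrder p A) {(y : A)}) :
    IsUniformizer p y := by
  obtain ⟨c, hc, hxy⟩ := mem_span_singleton_iff.1
    (h ▸ Submodule.mem_span_singleton_self _ : (x : A) ∈ Submodule.span (maxOrder p A) {(y : A)})
  obtain ⟨c', hc', hyx⟩ := mem_span_singleton_iff.1
    (h ▸ Submodule.mem_span_singleton_self _ : (y : A) ∈ Submodule.span (maxOrder p A) {(x : A)})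
  have hcc : c' * c = 1 := by
    rw [hxy, ← mul_assoc] at hyx
    exact mul_right_cancel₀ y.ne_zero (by rw [← hyx, one_mul])
  have hc'i : c'⁻¹ = c := inv_eq_of_mul_eq_one_right hcc
  have hci : c⁻¹ = c' := inv_eq_of_mul_eq_one_left hcc
  have hc0 : c ≠ 0 := right_ne_zero_of_mul_eq_one hcc
  refine ⟨hyx ▸ mul_mem hc' hx.mem, fun hy => hx.inv_notMem ?_, fun z hz hz' => ?_,
    fun z hz => ?_⟩
  · rw [hxy, mul_inv, hci]; exact mul_mem hc' hy
  · obtain ⟨w, hw, rfl⟩ := hx.exists_eq_mul z hz hz'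
    exact ⟨w * c, mul_mem hw hc, by rw [hxy, mul_assoc]⟩
  · obtain ⟨w, hw, hw', n, rfl⟩ := hx.exists_eq_mul_zpow z hz
    have hzp : ∀ (t : A), t ∈ maxOrder p A → t⁻¹ ∈ maxOrder p A → ∀ m : ℤ,
        t ^ m ∈ maxOrder p A := by
      intro t ht ht' m
      cases m with
      | ofNat m => rw [Int.ofNat_eq_natCast, zpow_natCast]; exact pow_mem ht m
      | negSucc m => rw [zpow_negSucc, ← inv_pow]; exact pow_mem ht' _
    have hci' : c⁻¹ ∈ maxOrder p A := hci ▸ hc'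
    refine ⟨w * c ^ n, mul_mem hw (hzp c hc hci' n), ?_, n, ?_⟩
    · rw [mul_inv, ← zpow_neg]; exact mul_mem hw' (hzp c hc hci' _)
    · rw [Units.val_zpow_eq_zpow_val, Units.val_zpow_eq_zpow_val, hxy, mul_zpow, mul_assoc]

include hE hσ

/-- Every lattice in a hermitian space over a quadratic étale algebra is free. -/
theorem IsFullLattice.exists_basis {V : Type*} [AddCommGroup V] [Module E V]
    (H : HermitianForm σ V) {L : Submodule (maxOrder p E) V} (hL : IsFullLattice p L) :
    ∃ (n : ℕ) (b : Module.Basis (Fin n) E V),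
      L = Submodule.span (maxOrder p E) (Set.range b) := by
  have hfin : FiniteDimensional K E := Module.finite_of_finrank_pos (by omega)
  have hfinp : Module.Finite ℚ_[p] E := Module.Finite.trans K E
  by_cases hF : IsField E
  · let := hF.toField
    exact exists_basis_span_eq_of_field hL.fg hL.span_eq_top
  · obtain ⟨e, he⟩ := exists_isSplitIdempotent hE hσ hF
    let : Module K V := Module.compHom V (algebraMap K E)
    have : IsScalarTower K E V := IsScalarTower.of_algebraMap_smul fun _ _ => rfl
    exact he.exists_basis_span_eq hE hσ H hL.fg hL.span_eq_top

theorem IsRamified.exists_residue (hR : IsRamified p σ) {π : Kˣ} (hπ : IsUniformizer p π) {θ : E}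
    (hθ : IsMaxOrderGen p K θ) :
    (∃ ϖ : Eˣ, invIdeal p σ = Submodule.span (maxOrder p E) {(ϖ : E)} ∧
      Submodule.span (maxOrder p E) {((ϖ ^ 2 : Eˣ) : E)} =
        Submodule.span (maxOrder p E) {algebraMap K E π}) ∧
    ∃ (k : Type u) (_ : Field k) (ρ : maxOrder p E →+* k), (∀ x, ρ x ≠ 0 → IsUnit x) ∧
      (∀ y, ∃ (a : K) (ha : a ∈ maxOrder p K),
        ρ ⟨algebraMap K E a, algebraMap_mem_maxOrder ha⟩ = y) ∧
      ∀ x : maxOrder p E, ρ ⟨σ x, apply_mem_maxOrder σ x.2⟩ = ρ x := by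
  have hfin : FiniteDimensional K E := Module.finite_of_finrank_pos (by omega)
  have hfinp : Module.Finite ℚ_[p] E := Module.Finite.trans K E
  obtain ⟨hF, hne⟩ := hR
  let := hF.toField
  obtain ⟨ϖ, hϖ⟩ := exists_isUniformizer p E
  have h1 : invIdeal p σ = Submodule.span (maxOrder p E) {(ϖ : E)} := hϖ.invIdeal_eq σ
  rw [hπ.maxIdeal_eq, extendIdeal_span, h1] at hne
  exact ⟨⟨ϖ, h1, hϖ.span_sq_eq_of_ramified hπ σ hne hE hσ⟩,
    hϖ.exists_residue hπ σ hne hθ⟩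

theorem invIdeal_eq_of_not_isRamified (hR : ¬ IsRamified p σ) {π : Kˣ} (hπ : IsUniformizer p π) :
    invIdeal p σ = Submodule.span (maxOrder p E) {algebraMap K E π} := by
  by_cases hF : IsField E
  · have : extendIdeal p E (maxIdeal p K) = invIdeal p σ := by
      by_contra h; exact hR ⟨hF, h⟩
    rw [← this, hπ.maxIdeal_eq, extendIdeal_span]
  · obtain ⟨e, he⟩ := exists_isSplitIdempotent hE hσ hF
    exact he.invIdeal_eq hE hπ

/-- Outside the ramified case, the congruence modulo the relative different is no restriction on
norm-one units. This settles the case where `c δ` is a unit. -/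
theorem sub_one_mem_span_of_not_isRamified (hR : ¬ IsRamified p σ) {θ : E}
    (hθ : IsMaxOrderGen p K θ) {u : E} (hu : u ∈ maxOrder p E) (hu1 : u * σ u = 1) :
    u - 1 ∈ Submodule.span (maxOrder p E) {θ - σ θ} := by
  have hfin : FiniteDimensional K E := Module.finite_of_finrank_pos (by omega)
  have hfinp : Module.Finite ℚ_[p] E := Module.Finite.trans K E
  by_cases hF : IsField E
  · obtain ⟨π, hπ⟩ := exists_isUniformizer p K
    have h2 := invIdeal_eq_of_not_isRamified hE hσ hR hπ
    let := hF.toField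
    obtain ⟨ϖ, hϖ⟩ := exists_isUniformizer p E
    have h1 : invIdeal p σ = Submodule.span (maxOrder p E) {(ϖ : E)} := hϖ.invIdeal_eq σ
    have h3 : IsUniformizer p (Units.map (algebraMap K E).toMonoidHom π) :=
      hϖ.of_span_eq (h1.symm.trans h2)
    exact IsUniformizer.sub_one_mem_span_of_unramified hE hσ hθ h3 hu1
  · obtain ⟨e, he⟩ := exists_isSplitIdempotent hE hσ hF
    exact he.sub_one_mem_span hθ hu

end Etale

/-! ### Norm, scale and trace dual of a hermitian lattice -/

section Lattice

variable {p : ℕ} [Fact p.Prime] {K E : Type*} [Field K] [CommRing E] [Algebra K E]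
  [Algebra ℤ_[p] K] [Algebra ℤ_[p] E] [IsScalarTower ℤ_[p] K E]
  [Algebra ℚ_[p] K] [FiniteDimensional ℚ_[p] K] [IsScalarTower ℤ_[p] ℚ_[p] K]
  [Algebra ℚ_[p] E] [IsScalarTower ℤ_[p] ℚ_[p] E] [IsScalarTower ℚ_[p] K E]
  [CharZero K] [IsReduced E]
  {σ : E ≃ₐ[K] E}
  {V : Type*} [AddCommGroup V] [Module E V] {H : HermitianForm σ V}
  {L : Submodule (maxOrder p E) V}

theorem mem_detSharp_iff {u : Eˣ} : u ∈ detSharp p H L ↔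
    ∃ φ : V ≃ₗ[E] V, (∀ x y, H.form (φ x) (φ y) = H.form x y) ∧ (∀ x, φ x ∈ L ↔ x ∈ L) ∧
      (∀ x ∈ traceDual p H L, φ x - x ∈ L) ∧ LinearEquiv.det φ = u := by
  have key : ∀ φ : unitaryGroup p H L, φ ∈ unitarySharp p H L ↔
      ∀ x ∈ traceDual p H L, (φ : V ≃ₗ[E] V) x - x ∈ L := by
    intro φ
    rw [unitarySharp, MonoidHom.mem_ker]
    constructor
    · intro h x hx
      have h1 := congrArg (fun f => f (Submodule.Quotient.mk ⟨x, hx⟩)) h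
      exact (Submodule.Quotient.eq (L.submoduleOf (traceDual p H L))).1 h1
    · intro h
      refine LinearMap.ext fun x => ?_
      induction x using Submodule.Quotient.induction_on with
      | H x => exact (Submodule.Quotient.eq _).2 (h x x.2)
  constructor
  · rintro ⟨φ, hφ, rfl⟩
    exact ⟨φ, φ.2.1, φ.2.2, (key φ).1 hφ, rfl⟩
  · rintro ⟨φ, h1, h2, h3, rfl⟩
    exact ⟨⟨φ, h1, h2⟩, (key _).2 h3, rfl⟩

theorem HermitianForm.exists_algebraMap_eq_form_self (hE : Module.finrank K E = 2)
    (hσ : σ ≠ AlgEquiv.refl) (H : HermitianForm σ V) (x : V) :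
    ∃ c, algebraMap K E c = H.form x x :=
  exists_algebraMap_eq_of_apply_eq hE hσ (H.conj_symm x x).symm

variable (hE : Module.finrank K E = 2) (hσ : σ ≠ AlgEquiv.refl)
  {θ : E} (hθ : IsMaxOrderGen p K θ) {δ : K} (hδ : δ ≠ 0)
  (hK : inverseDifferent p K = Submodule.span (maxOrder p K) {δ⁻¹})

include hE hσ

theorem exists_form_self_eq {c : K} (hc : latticeNorm p H L = Submodule.span (maxOrder p K) {c})
    {x : V} (hx : x ∈ L) : ∃ r ∈ maxOrder p K, H.form x x = algebraMap K E (r * c) := by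
  obtain ⟨a, ha⟩ := H.exists_algebraMap_eq_form_self hE hσ x
  have h1 : a ∈ latticeNorm p H L := Submodule.subset_span ⟨x, hx, ha⟩
  rw [hc, mem_span_singleton_iff] at h1
  obtain ⟨r, hr, rfl⟩ := h1
  exact ⟨r, hr, ha.symm⟩

include hθ

/-- The scale of a hermitian lattice is bounded by its norm. -/
theorem exists_form_mul_eq {c : K} (hc0 : c ≠ 0)
    (hc : latticeNorm p H L = Submodule.span (maxOrder p K) {c})
    {x y : V} (hx : x ∈ L) (hy : y ∈ L) :
    ∃ r ∈ maxOrder p E, H.form x y * (θ - σ θ) = algebraMap K E c * r := by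
  have : Nontrivial E := Module.nontrivial_of_finrank_pos (R := K) (by omega)
  have hcc : algebraMap K E c⁻¹ * algebraMap K E c = 1 := by
    rw [← map_mul, inv_mul_cancel₀ hc0, map_one]
  refine ⟨algebraMap K E c⁻¹ * H.form x y * (θ - σ θ), ?_, by
    linear_combination (-H.form x y * (θ - σ θ)) * hcc⟩
  -- Polarization: `Tr (z h(x, y))` is `h(zx + y, zx + y) - h(zx, zx) - h(y, y)`, which lies in the
  -- norm. The trace criterion turns this into a bound on `h(x, y)` itself.
  rw [← hθ.forall_trace_mul_mem_iff hE hσ]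
  intro z hz
  have hzx : z • x ∈ L := L.smul_mem (⟨z, hz⟩ : maxOrder p E) hx
  obtain ⟨r1, hr1, h1⟩ := exists_form_self_eq hE hσ hc (add_mem hzx hy)
  obtain ⟨r2, hr2, h2⟩ := exists_form_self_eq hE hσ hc hzx
  obtain ⟨r3, hr3, h3⟩ := exists_form_self_eq hE hσ hc hy
  have h4 : algebraMap K E (Algebra.trace K E (algebraMap K E c⁻¹ * H.form x y * z)) =
      algebraMap K E (r1 - r2 - r3) := by
    rw [mul_assoc, ← Algebra.smul_def, map_smul, smul_eq_mul, map_mul,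
      algebraMap_trace_eq hE hσ]
    have h5 : H.form x y * z = H.form (z • x) y := by
      rw [map_smul, LinearMap.smul_apply, smul_eq_mul, mul_comm]
    rw [h5, ← H.conj_symm]
    have h6 : H.form (z • x + y) (z • x + y) = H.form (z • x) (z • x) + H.form (z • x) y +
        H.form y (z • x) + H.form y y := by
      simp only [map_add, LinearMap.add_apply]; ring
    rw [h6, h2, h3, map_mul, map_mul, map_mul] at h1
    rw [map_sub, map_sub]
    linear_combination algebraMap K E c⁻¹ * h1 +
      (algebraMap K E r1 - algebraMap K E r2 - algebraMap K E r3) * hcc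
  rw [(algebraMap K E).injective h4]
  exact sub_mem (sub_mem hr1 hr2) hr3

include hδ hK

/-- As `L` is stable under `𝒪`, integrality of the trace of `h(x, y)` for all `y ∈ L` amounts to
`h(x, y)` lying in the inverse different. -/
theorem mem_traceDual_iff {x : V} : x ∈ traceDual p H L ↔
    ∀ y ∈ L, H.form x y * (algebraMap K E δ * (θ - σ θ)) ∈ maxOrder p E := by
  have : x ∈ traceDual p H L ↔ ∀ y ∈ L, H.form x y ∈ inverseDifferent p E := by
    constructor
    · intro h y hy z hz
      have h1 := h (σ z • y) (L.smul_mem (⟨σ z, apply_mem_maxOrder σ hz⟩ : maxOrder p E) hy)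
      rw [LinearMap.map_smulₛₗ, smul_eq_mul] at h1
      convert h1 using 2
      rw [mul_comm]
      congr 1
      exact (apply_apply_eq_self hE hσ z).symm
    · intro h y hy
      have := h y hy 1 (one_mem _)
      rwa [mul_one] at this
  rw [this]
  exact forall₂_congr fun y _ => hθ.mem_inverseDifferent_iff hE hσ hδ hK

end Lattice

/-! ### Coordinates for isometries acting trivially on the discriminant module -/

section Sharp

variable {p : ℕ} [Fact p.Prime] {K E : Type*} [Field K] [CommRing E] [Algebra K E]
  [Algebra ℤ_[p] K] [Algebra ℤ_[p] E] [IsScalarTower ℤ_[p] K E]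
  [Algebra ℚ_[p] K] [FiniteDimensional ℚ_[p] K] [IsScalarTower ℤ_[p] ℚ_[p] K]
  [Algebra ℚ_[p] E] [IsScalarTower ℤ_[p] ℚ_[p] E] [IsScalarTower ℚ_[p] K E]
  [CharZero K] [IsReduced E] (hE : Module.finrank K E = 2)
  {σ : E ≃ₐ[K] E} (hσ : σ ≠ AlgEquiv.refl)
  {V : Type*} [AddCommGroup V] [Module E V] {H : HermitianForm σ V}
  {L : Submodule (maxOrder p E) V}

/-- The restriction of `σ` to the maximal order, as a star ring structure. -/
abbrev starRingMaxOrder (p : ℕ) [Fact p.Prime] [Algebra ℤ_[p] K] [Algebra ℤ_[p] E]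
    [IsScalarTower ℤ_[p] K E] (hE : Module.finrank K E = 2) (hσ : σ ≠ AlgEquiv.refl) :
    StarRing (maxOrder p E) where
  star x := ⟨σ x, apply_mem_maxOrder σ x.2⟩
  star_involutive x := Subtype.ext (apply_apply_eq_self hE hσ x)
  star_mul x y := Subtype.ext (by simp [mul_comm])
  star_add x y := Subtype.ext (by simp)

include hE hσ in
/-- The dual basis of a basis with respect to a hermitian form. -/
theorem exists_dual_basis (H : HermitianForm σ V) {n : ℕ} (b : Module.Basis (Fin n) E V) :
    ∃ w : Module.Basis (Fin n) E V, (∀ y i, w.repr y i = H.form y (b i)) ∧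
      ∀ i j, H.form (w j) (b i) = if j = i then 1 else 0 := by
  have hfin : FiniteDimensional K E := Module.finite_of_finrank_pos (by omega)
  have : IsArtinianRing E := IsArtinianRing.of_finite K E
  let ψ : V →ₗ[E] (Fin n → E) := LinearMap.pi fun i =>
    { toFun := fun y => H.form y (b i)
      map_add' := fun x y => by rw [map_add, LinearMap.add_apply]
      map_smul' := fun c x => by rw [map_smul, LinearMap.smul_apply, RingHom.id_apply] }
  have hinj : Function.Injective ψ := by
    rw [injective_iff_map_eq_zero]
    intro y hy
    apply H.nondegenerate
    intro z
    rw [← b.sum_repr z, map_sum]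
    refine Finset.sum_eq_zero fun i _ => ?_
    rw [LinearMap.map_smulₛₗ, show H.form y (b i) = 0 from congrFun hy i, smul_zero]
  -- `E` need not be a field, so dimension counting is replaced by the fact that an injective
  -- endomorphism of an Artinian module is surjective.
  have hsurj : Function.Surjective ψ := by
    have h1 : Function.Injective (ψ ∘ₗ b.equivFun.symm.toLinearMap) :=
      hinj.comp b.equivFun.symm.injective
    have h2 := IsArtinian.surjective_of_injective_endomorphism _ h1
    exact Function.Surjective.of_comp h2
  let w := Module.Basis.ofEquivFun (LinearEquiv.ofBijective ψ ⟨hinj, hsurj⟩)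
  have hw : ∀ y i, w.repr y i = H.form y (b i) := fun y i => by
    rw [Module.Basis.ofEquivFun_repr_apply]; rfl
  refine ⟨w, hw, fun i j => ?_⟩
  rw [← hw, w.repr_self, Finsupp.single_apply]

variable {θ : E} (hθ : IsMaxOrderGen p K θ) {δ : K} (hδ : δ ≠ 0)
  (hK : inverseDifferent p K = Submodule.span (maxOrder p K) {δ⁻¹})
  {c : K} (hc0 : c ≠ 0) (hc : latticeNorm p H L = Submodule.span (maxOrder p K) {c})
  (he : c * δ ∈ maxOrder p K)

open Matrix

include hE hσ hθ hδ hK hc0 hc he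

/-- Matrix form of an isometry that acts trivially on the discriminant module. -/
theorem exists_matrix_of_sharp (hL : IsFullLattice p L) {φ : V ≃ₗ[E] V}
    (hφ : ∀ x y, H.form (φ x) (φ y) = H.form x y)
    (hφs : ∀ x ∈ traceDual p H L, φ x - x ∈ L) :
    letI := starRingMaxOrder p hE hσ
    ∃ (n : ℕ) (T G : Matrix (Fin n) (Fin n) (maxOrder p E)) (e : maxOrder p E),
      (e : E) = algebraMap K E (c * δ) ∧
      e • G = (e • G)ᴴ + (e • G)ᴴ * (T - Tᴴ) * (e • G) ∧
      ((LinearEquiv.det φ : Eˣ) : E) = ((1 + (T - Tᴴ) * (e • G)).det : maxOrder p E) := by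
  let := starRingMaxOrder p hE hσ
  have hstar : ∀ x : maxOrder p E, ((star x : maxOrder p E) : E) = σ x := fun _ => rfl
  obtain ⟨n, b, hb⟩ := hL.exists_basis hE hσ H
  obtain ⟨d, hd, hσd⟩ := hθ.exists_units_eq_sub_apply hE hσ
  obtain ⟨w, hw, hwb⟩ := exists_dual_basis hE hσ H b
  have hmem : ∀ {x}, x ∈ L → ∀ i, b.repr x i ∈ maxOrder p E := by
    intro x hx i
    rw [hb] at hx
    induction hx using Submodule.span_induction with
    | mem x hx =>
      obtain ⟨j, rfl⟩ := hx
      rw [b.repr_self, Finsupp.single_apply]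
      split_ifs
      exacts [one_mem _, zero_mem _]
    | zero => rw [map_zero]; exact zero_mem _
    | add x y _ _ hx hy => rw [map_add]; exact add_mem hx hy
    | smul c x _ hx => rw [Subalgebra.smul_def, map_smul]; exact mul_mem c.2 hx
  have hbL : ∀ i, b i ∈ L := fun i => hb ▸ Submodule.subset_span ⟨i, rfl⟩
  set δu : Eˣ := Units.map (algebraMap K E).toMonoidHom (Units.mk0 δ hδ) with hδu
  have hδv : (δu : E) = algebraMap K E δ := rfl
  -- A generator of the inverse different of `E`, with `σ κ = -κ`. Scaling the dual basis by it
  -- gives vectors `X j` of `L^∨`, whose displacements `g j` under `φ` lie in `L`.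
  set κ : Eˣ := (δu * d)⁻¹ with hκ
  have hκ1 : (κ : E) * (algebraMap K E δ * d) = 1 := by
    rw [← hδv, ← Units.val_mul, hκ, Units.inv_mul]
  have hσκ : σ κ = -κ := by
    have h1 := congrArg σ hκ1
    rw [map_mul, map_mul, AlgEquiv.commutes, hσd, map_one] at h1
    linear_combination (-(κ : E)) * h1 - σ κ * hκ1
  have hwy : ∀ j y, H.form (w j) y = σ (b.repr y j) := by
    intro j y
    conv_lhs => rw [← b.sum_repr y, map_sum]
    simp only [LinearMap.map_smulₛₗ, hwb, smul_eq_mul, mul_ite, mul_one, mul_zero,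
      Finset.sum_ite_eq, Finset.mem_univ, if_true]
    rfl
  set X : Fin n → V := fun j => (κ : E) • w j with hX
  have hXy : ∀ j y, H.form (X j) y = κ * σ (b.repr y j) := fun j y => by
    simp only [hX, map_smul, LinearMap.smul_apply, smul_eq_mul, hwy]
  have hyX : ∀ y j, H.form y (X j) = -κ * b.repr y j := fun y j => by
    rw [H.conj_symm, hXy, map_mul, hσκ, apply_apply_eq_self hE hσ]
  have hXs : ∀ j, X j ∈ traceDual p H L := fun j => by
    rw [mem_traceDual_iff hE hσ hθ hδ hK]
    intro y hy
    rw [hXy, ← hd]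
    convert apply_mem_maxOrder σ (hmem hy j) using 1
    linear_combination σ (b.repr y j) * hκ1
  set g : Fin n → V := fun j => φ (X j) - X j with hg
  have hgL : ∀ j, g j ∈ L := fun j => hφs _ (hXs j)
  let G : Matrix (Fin n) (Fin n) (maxOrder p E) := of fun i j => ⟨b.repr (g j) i, hmem (hgL j) i⟩
  have hG : ∀ i j, (G i j : E) = b.repr (g j) i := fun _ _ => rfl
  have hgG : ∀ j, g j = ∑ i, (G i j : E) • b i := fun j => (b.sum_repr (g j)).symm
  choose r hr hrb using fun i l => exists_form_mul_eq hE hσ hθ hc0 hc (hbL i) (hbL l)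
  choose r' hr' hrb' using fun i => exists_form_self_eq hE hσ hc (hbL i)
  -- The Gram matrix (transposed) multiplied by `d / c`: integral by the scale bound, and
  -- skew-hermitian because `σ d = -d`.
  let H₀ : Matrix (Fin n) (Fin n) (maxOrder p E) := of fun l i => ⟨r i l, hr i l⟩
  have hH₀ : ∀ i l, H.form (b i) (b l) * d = algebraMap K E c * H₀ l i := fun i l => by
    rw [hd]; exact hrb i l
  have hcu : IsUnit (algebraMap K E c) := (IsUnit.mk0 c hc0).map _
  have hH₀d : ∀ i, (H₀ i i : E) = algebraMap K E (r' i) * d := fun i => by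
    apply hcu.mul_left_cancel
    rw [← hH₀, hrb', map_mul]; ring
  have hH₀s : ∀ i j, σ (H₀ i j : E) = -H₀ j i := fun i j => by
    apply hcu.mul_left_cancel
    have h1 := congrArg σ (hH₀ j i)
    rw [map_mul, map_mul, AlgEquiv.commutes, ← H.conj_symm, hσd] at h1
    linear_combination -h1 - hH₀ i j
  -- The strict upper triangle of `H₀`, with diagonal entries `r' θ`. These exist because `h(b i, b
  -- i) = r' c` with `r' ∈ 𝔬`, so the diagonal of `H₀` is `r' d = r' θ - σ (r' θ)`.
  let T : Matrix (Fin n) (Fin n) (maxOrder p E) := of fun i j =>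
    if i < j then H₀ i j else if i = j then
      ⟨algebraMap K E (r' i) * θ, mul_mem (algebraMap_mem_maxOrder (hr' i)) hθ.mem⟩ else 0
  have hT : T - Tᴴ = H₀ := by
    ext i j
    rw [Matrix.sub_apply, conjTranspose_apply]
    simp only [T, of_apply]
    rcases lt_trichotomy i j with h | h | h
    · simp [h, h.not_gt, h.ne']
    · subst h
      simp only [lt_irrefl, if_false, if_true, AddSubgroupClass.coe_sub, hstar, map_mul,
        AlgEquiv.commutes, hH₀d, hd]
      ring
    · simp [h, h.not_gt, h.ne', hstar, hH₀s]
  let e : maxOrder p E := ⟨algebraMap K E (c * δ), algebraMap_mem_maxOrder he⟩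
  have heE : (e : E) = algebraMap K E c * algebraMap K E δ := map_mul _ _ _
  have hform : ∀ j y, H.form (g j) y = ∑ i, (G i j : E) * H.form (b i) y := fun j y => by
    rw [hgG, map_sum, LinearMap.sum_apply]
    simp only [map_smul, LinearMap.smul_apply, smul_eq_mul]
  refine ⟨n, T, G, e, rfl, ?_, ?_⟩
  · rw [hT]
    ext k j
    have hform2 : ∀ i k, H.form (b i) (g k) = ∑ l, σ (G l k : E) * H.form (b i) (b l) :=
      fun i k => by
        rw [hgG, map_sum]
        simp only [LinearMap.map_smulₛₗ, smul_eq_mul]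
        rfl
    -- Expanding `h(φ X_j, φ X_k) = h(X_j, X_k)` with `φ X = X + g` and clearing `κ` gives the
    -- matrix equation for `e G`.
    have hiso := hφ (X j) (X k)
    have hφX : ∀ j, φ (X j) = X j + g j := fun j => by simp [hg]
    rw [hφX, hφX] at hiso
    simp only [map_add, LinearMap.add_apply] at hiso
    rw [hyX (g j), hXy j (g k), hform j (g k), ← hG, ← hG] at hiso
    simp only [hform2, Finset.mul_sum] at hiso
    have hsum : (((e • G)ᴴ * H₀ * (e • G)) k j : maxOrder p E) =
        (e : E) * algebraMap K E δ * d *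
          ∑ i, ∑ l, (G i j : E) * (σ (G l k : E) * H.form (b i) (b l)) := by
      rw [Matrix.mul_apply, AddSubmonoidClass.coe_finsetSum, Finset.mul_sum]
      refine Finset.sum_congr rfl fun i _ => ?_
      rw [Matrix.mul_apply, MulMemClass.coe_mul, AddSubmonoidClass.coe_finsetSum, Finset.sum_mul,
        Finset.mul_sum]
      refine Finset.sum_congr rfl fun l _ => ?_
      have hσe : σ (e : E) = e := AlgEquiv.commutes σ _
      simp only [conjTranspose_apply, Matrix.smul_apply, smul_eq_mul, MulMemClass.coe_mul, hstar,
        map_mul, hσe]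
      rw [heE]
      linear_combination (-(algebraMap K E c) * (algebraMap K E δ) ^ 2 * σ (G l k : E) *
        (G i j : E)) * hH₀ i l
    have hσe : σ (e : E) = e := AlgEquiv.commutes σ _
    rw [Matrix.add_apply, AddMemClass.coe_add, hsum]
    simp only [conjTranspose_apply, Matrix.smul_apply, smul_eq_mul, MulMemClass.coe_mul, hstar,
        map_mul, hσe]
    linear_combination (-(e : E) * algebraMap K E δ * d) * hiso +
      (-(e : E) * ((G k j : E) - σ (G j k : E))) * hκ1
  · rw [hT, LinearEquiv.coe_det, ← LinearMap.det_toMatrix w]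
    have : ((1 + H₀ * (e • G)).det : E) =
        ((algebraMap (maxOrder p E) E).mapMatrix (1 + H₀ * (e • G))).det := by
      rw [← RingHom.map_det]; rfl
    rw [this]
    congr 1
    ext l j
    rw [LinearMap.toMatrix_apply, hw]
    have h1 : φ (w j) = w j + (algebraMap K E δ * (d : E)) • g j := by
      simp only [hg, hX]
      rw [smul_sub, map_smul, smul_smul, smul_smul, mul_comm _ (κ : E), hκ1, one_smul, one_smul]
      abel
    rw [LinearEquiv.coe_coe, h1, map_add, LinearMap.add_apply, hwb, map_smul, LinearMap.smul_apply,
      smul_eq_mul, hform, RingHom.mapMatrix_apply, Matrix.map_apply, Matrix.add_apply, map_add,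
      Matrix.mul_apply, map_sum, Finset.mul_sum]
    congr 1
    · rw [Matrix.one_apply]
      by_cases h : j = l
      · simp [h]
      · simp [h, Ne.symm h]
    · refine Finset.sum_congr rfl fun i _ => ?_
      change _ = ((H₀ l i * (e • G) i j : maxOrder p E) : E)
      simp only [Matrix.smul_apply, smul_eq_mul, MulMemClass.coe_mul, heE]
      linear_combination (algebraMap K E δ * (G i j : E)) * hH₀ i l

end Sharp

/-! ### Both inclusions for the group of determinants -/

section Determinants

variable {p : ℕ} [Fact p.Prime] {K E : Type*} [Field K] [CommRing E] [Algebra K E]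
  [Algebra ℤ_[p] K] [Algebra ℤ_[p] E] [IsScalarTower ℤ_[p] K E]
  [Algebra ℚ_[p] K] [FiniteDimensional ℚ_[p] K] [IsScalarTower ℤ_[p] ℚ_[p] K]
  [Algebra ℚ_[p] E] [IsScalarTower ℤ_[p] ℚ_[p] E] [IsScalarTower ℚ_[p] K E]
  [CharZero K] [IsReduced E] (hE : Module.finrank K E = 2)
  {σ : E ≃ₐ[K] E} (hσ : σ ≠ AlgEquiv.refl)
  {V : Type*} [AddCommGroup V] [Module E V] {H : HermitianForm σ V}
  {L : Submodule (maxOrder p E) V}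
  {θ : E} (hθ : IsMaxOrderGen p K θ)

open Matrix

include hE hσ hθ

/-- An element `z / σ z` with `z = 1 + e y` a unit is congruent to `1` modulo `e (θ - σ θ)`. -/
theorem sub_one_mem_span_of_mul_star_eq {e : K} {u z y : maxOrder p E} (hz : IsUnit z)
    (hzy : (z : E) = 1 + algebraMap K E e * y) (huz : (u : E) * σ z = z) :
    (u : E) - 1 ∈ Submodule.span (maxOrder p E) {algebraMap K E e * (θ - σ θ)} := by
  obtain ⟨v, hv⟩ := hz.exists_right_inv
  have hv' : σ (z : E) * σ v = 1 := by
    rw [← map_mul, show (z : E) * v = 1 from congrArg Subtype.val hv, map_one]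
  obtain ⟨b, hb, h⟩ := hθ.exists_sub_apply_eq σ y.2
  refine mem_span_singleton_iff.2 ⟨σ v * algebraMap K E b,
    mul_mem (apply_mem_maxOrder σ v.2) (algebraMap_mem_maxOrder hb), ?_⟩
  have h1 : (z : E) - σ z = algebraMap K E e * (y - σ y) := by
    rw [hzy, map_add, map_mul, map_one, AlgEquiv.commutes]; ring
  rw [h] at h1
  linear_combination (1 - (u : E)) * hv' + σ v * huz + σ v * h1

/-- The norm of `z` has the form `1 + π s` with `s ∈ 𝔬`, a unit of `𝔬`. Passing to the norm covers
split `E`, whose maximal order is not local. -/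
theorem isUnit_one_add_mul {e : K} (he : e ∈ maxOrder p K) (he' : e⁻¹ ∉ maxOrder p K)
    {z y : maxOrder p E} (hzy : (z : E) = 1 + algebraMap K E e * y) : IsUnit z := by
  have : Nontrivial E := Module.nontrivial_of_finrank_pos (R := K) (by omega)
  obtain ⟨π, hπ⟩ := exists_isUniformizer p K
  obtain ⟨e, heo, rfl⟩ := hπ.exists_eq_mul e he he'
  obtain ⟨m, hm⟩ := exists_algebraMap_eq_mul_apply hE hσ (y : E)
  have hmo : m ∈ maxOrder p K := by
    rw [← algebraMap_mem_maxOrder_iff (E := E), hm]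
    exact mul_mem y.2 (apply_mem_maxOrder σ y.2)
  set t := Algebra.trace K E (y : E) with ht
  have htr : algebraMap K E t = y + σ y := algebraMap_trace_eq hE hσ _
  have hto : t ∈ maxOrder p K := by
    rw [← algebraMap_mem_maxOrder_iff (E := E), htr]
    exact add_mem y.2 (apply_mem_maxOrder σ y.2)
  set s := e * t + e * (e * π) * m with hs
  have hso : s ∈ maxOrder p K := add_mem (mul_mem heo hto)
    (mul_mem (mul_mem heo (mul_mem heo hπ.mem)) hmo)
  have hN : (z : E) * σ z = algebraMap K E (1 + π * s) := by
    rw [hzy, hs]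
    simp only [map_add, map_mul, map_one, AlgEquiv.commutes, htr, hm]
    ring
  have hinv : (1 + π * s)⁻¹ ∈ maxOrder p K := by
    by_contra h
    obtain ⟨w, hw, hw'⟩ := hπ.exists_eq_mul _
      (add_mem (one_mem _) (mul_mem hπ.mem hso)) h
    apply hπ.inv_notMem
    have : (π : K)⁻¹ = w - s := by
      rw [inv_eq_of_mul_eq_one_right]
      linear_combination -hw'
    rw [this]
    exact sub_mem hw hso
  have hne : 1 + π * s ≠ 0 := fun h => hπ.inv_notMem (by
    have : (π : K)⁻¹ = -s := by
      rw [inv_eq_of_mul_eq_one_right]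
      linear_combination -h
    rw [this]; exact neg_mem hso)
  refine IsUnit.of_mul_eq_one (⟨σ z * algebraMap K E (1 + π * s)⁻¹,
    mul_mem (apply_mem_maxOrder σ z.2) (algebraMap_mem_maxOrder hinv)⟩ : maxOrder p E)
    (Subtype.ext ?_)
  change (z : E) * (σ z * algebraMap K E (1 + π * s)⁻¹) = 1
  rw [← mul_assoc, hN, ← map_mul, mul_inv_cancel₀ hne, map_one]

variable {δ : K} (hδ : δ ≠ 0)
  (hK : inverseDifferent p K = Submodule.span (maxOrder p K) {δ⁻¹})
  {c : K} (hc0 : c ≠ 0) (hc : latticeNorm p H L = Submodule.span (maxOrder p K) {c})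
  (he : c * δ ∈ maxOrder p K)

include hδ hK hc0 hc he

/-- The determinant `U` satisfies `U σ(z) = z` with `z = det (1 - Tᴴ Γ) ≡ 1` modulo `c δ`. The case
distinction only serves to make `z` a unit or to avoid needing it. -/
theorem det_mem_of_sharp (hL : IsFullLattice p L) {φ : V ≃ₗ[E] V}
    (hφ : ∀ x y, H.form (φ x) (φ y) = H.form x y)
    (hφs : ∀ x ∈ traceDual p H L, φ x - x ∈ L) :
    ((LinearEquiv.det φ : Eˣ) : E) ∈ maxOrder p E ∧
    (((LinearEquiv.det φ)⁻¹ : Eˣ) : E) ∈ maxOrder p E ∧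
    ((LinearEquiv.det φ : Eˣ) : E) * σ (LinearEquiv.det φ : Eˣ) = 1 ∧
    ((LinearEquiv.det φ : Eˣ) : E) - 1 ∈
      Submodule.span (maxOrder p E) {algebraMap K E (c * δ) * (θ - σ θ)} := by
  have : Nontrivial E := Module.nontrivial_of_finrank_pos (R := K) (by omega)
  let := starRingMaxOrder p hE hσ
  obtain ⟨n, T, G, e, heE, hG, hdet⟩ :=
    exists_matrix_of_sharp hE hσ hθ hδ hK hc0 hc he hL hφ hφs
  have hstar : ∀ x : maxOrder p E, ((star x : maxOrder p E) : E) = σ x := fun _ => rfl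
  set U := (1 + (T - Tᴴ) * (e • G)).det with hU
  have hU1 : star U * U = 1 := star_det_mul_det_one_add (by
    rw [conjTranspose_sub, conjTranspose_conjTranspose, neg_sub]) hG
  have hU2 : (U : E) * σ U = 1 := by
    rw [mul_comm]; exact congrArg Subtype.val hU1
  rw [Units.inv_eq_of_mul_eq_one_right (show ((LinearEquiv.det φ : Eˣ) : E) * σ U = 1 by
    rw [hdet, hU2]), hdet]
  refine ⟨U.2, apply_mem_maxOrder σ U.2, hU2, ?_⟩
  have key : ∀ T' : Matrix (Fin n) (Fin n) (maxOrder p E), T' - T'ᴴ = T - Tᴴ →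
      IsUnit (1 - T'ᴴ * (e • G)).det → (U : E) - 1 ∈
        Submodule.span (maxOrder p E) {algebraMap K E (c * δ) * (θ - σ θ)} := by
    intro T' hT' hu
    obtain ⟨y, hy⟩ := exists_det_one_sub_mul_smul_eq T'ᴴ G e
    rw [← hT'] at hG hU
    have h1 := det_one_add_mul_star_det hG
    rw [← hU] at h1
    refine sub_one_mem_span_of_mul_star_eq (y := y) hE hσ hθ hu ?_ (congrArg Subtype.val h1)
    rw [hy, ← heE]
    rfl
  by_cases hR : IsRamified p σ
  · obtain ⟨π, hπ⟩ := exists_isUniformizer p K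
    obtain ⟨-, k, _, ρ, hρu, hρs, hρσ⟩ := hR.exists_residue hE hσ hπ hθ
    -- Residues lift to elements of `𝔬`, which `σ` fixes, so `T` can be corrected by a hermitian
    -- matrix until `z` is nonzero in the residue field.
    obtain ⟨T', hT', hdet'⟩ := exists_map_det_one_sub_ne_zero (ρ := ρ) hρσ (fun y => by
      obtain ⟨a, ha, h⟩ := hρs y
      exact ⟨_, Subtype.ext (AlgEquiv.commutes σ a), h⟩) hG
    exact key T' hT' (hρu _ hdet')
  · by_cases hei : (c * δ)⁻¹ ∈ maxOrder p K
    · obtain ⟨r, hr, h⟩ := mem_span_singleton_iff.1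
        (sub_one_mem_span_of_not_isRamified hE hσ hR hθ U.2 hU2)
      refine mem_span_singleton_iff.2 ⟨r * algebraMap K E (c * δ)⁻¹,
        mul_mem hr (algebraMap_mem_maxOrder hei), ?_⟩
      have h1 : algebraMap K E (c * δ)⁻¹ * algebraMap K E (c * δ) = 1 := by
        rw [← map_mul, inv_mul_cancel₀ (mul_ne_zero hc0 hδ), map_one]
      linear_combination h - r * (θ - σ θ) * h1
    · refine key T rfl ?_
      obtain ⟨y, hy⟩ := exists_det_one_sub_mul_smul_eq Tᴴ G e
      refine isUnit_one_add_mul (y := y) hE hσ hθ he hei ?_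
      rw [hy, ← heE]
      rfl

omit hδ hK he in
-- If every value `h(x, x)` were a non-unit multiple of `c`, all of them would lie in `π c 𝔬`, and
-- so would the norm.
theorem exists_form_self_generator :
    ∃ x ∈ L, ∃ r ∈ maxOrder p K, r⁻¹ ∈ maxOrder p K ∧ r ≠ 0 ∧
      H.form x x = algebraMap K E (r * c) := by
  have : Nontrivial E := Module.nontrivial_of_finrank_pos (R := K) (by omega)
  obtain ⟨π, hπ⟩ := exists_isUniformizer p K
  by_contra! hcon
  have h1 : latticeNorm p H L ≤ Submodule.span (maxOrder p K) {(π : K) * c} := by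
    rw [latticeNorm, Submodule.span_le]
    rintro a ⟨x, hx, ha⟩
    obtain ⟨r, hr, hrx⟩ := exists_form_self_eq hE hσ hc hx
    have har : a = r * c := (algebraMap K E).injective (ha.trans hrx)
    have h2 : ∃ s ∈ maxOrder p K, r = s * π := by
      by_cases hr0 : r = 0
      · exact ⟨0, zero_mem _, by rw [hr0, zero_mul]⟩
      · exact hπ.exists_eq_mul r hr fun hri => hcon x hx r hr hri hr0 hrx
    obtain ⟨s, hs, rfl⟩ := h2
    exact mem_span_singleton_iff.2 ⟨s, hs, by rw [har, mul_assoc]⟩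
  rw [hc, Submodule.span_singleton_le_iff_mem, mem_span_singleton_iff] at h1
  obtain ⟨s, hs, h2⟩ := h1
  apply hπ.inv_notMem
  have h3 : (π : K) * s = 1 := mul_right_cancel₀ hc0 (by linear_combination -h2)
  rwa [inv_eq_of_mul_eq_one_right h3]

/-- Every admissible unit is the determinant of a quasi-reflection. -/
theorem exists_sharp_det_eq (hL : IsFullLattice p L) {u : Eˣ}
    (hu' : ((u⁻¹ : Eˣ) : E) ∈ maxOrder p E) (hu1 : (u : E) * σ u = 1)
    (hud : (u : E) - 1 ∈
      Submodule.span (maxOrder p E) {algebraMap K E (c * δ) * (θ - σ θ)}) :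
    u ∈ detSharp p H L := by
  obtain ⟨x, hx, r, hr, hri, hr0, hrx⟩ := exists_form_self_generator hE hσ hθ hc0 hc
  obtain ⟨n, b, hb⟩ := hL.exists_basis hE hσ H
  have hfree : Module.Free E V := Module.Free.of_basis b
  have hfin : Module.Finite E V := Module.Finite.of_basis b
  set q : E := algebraMap K E (r * c)⁻¹ with hq
  have hqx : q * H.form x x = 1 := by
    rw [hrx, hq, ← map_mul, inv_mul_cancel₀ (mul_ne_zero hr0 hc0), map_one]
  have hσq : σ q = q := AlgEquiv.commutes σ _
  let f : E → Module.Dual E V := fun v =>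
    { toFun := fun y => (v - 1) * q * H.form y x
      map_add' := fun y z => by rw [map_add, LinearMap.add_apply, mul_add]
      map_smul' := fun a y => by
        rw [map_smul, LinearMap.smul_apply, smul_eq_mul, smul_eq_mul, RingHom.id_apply]; ring }
  have hf : ∀ v y, f v y = (v - 1) * q * H.form y x := fun _ _ => rfl
  -- Since `f v x = v - 1`, the quasi-reflection with parameter `v` scales `x` by `v`, and
  -- parameters multiply under composition.
  have hcomp : ∀ v w : E, v * w = 1 →
      LinearMap.transvection (f v) x ∘ₗ LinearMap.transvection (f w) x = LinearMap.id := by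
    intro v w hvw
    ext y
    rw [LinearMap.comp_apply, LinearMap.transvection.apply, LinearMap.transvection.apply,
      LinearMap.id_apply, map_add, map_smul, smul_eq_mul, add_assoc, ← add_smul]
    have : f w y + (f v y + f w y * f v x) = 0 := by
      simp only [hf]
      linear_combination (w - 1) * (v - 1) * q * H.form y x * hqx + q * H.form y x * hvw
    rw [this, zero_smul, add_zero]
  let φ : V ≃ₗ[E] V := LinearEquiv.ofLinearMap (LinearMap.transvection (f u) x)
    (LinearMap.transvection (f ((u⁻¹ : Eˣ) : E)) x) (hcomp _ _ u.mul_inv) (hcomp _ _ u.inv_mul)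
  have hφ : ∀ y, φ y = y + f u y • x := fun y => LinearMap.transvection.apply _ _ _
  have hφ' : ∀ y, φ.symm y = y + f ((u⁻¹ : Eˣ) : E) y • x := fun y =>
    LinearMap.transvection.apply _ _ _
  have hLdual : ∀ y ∈ L, y ∈ traceDual p H L := by
    intro y hy
    rw [mem_traceDual_iff hE hσ hθ hδ hK]
    intro z hz
    obtain ⟨s, hs, h⟩ := exists_form_mul_eq hE hσ hθ hc0 hc hy hz
    convert mul_mem (algebraMap_mem_maxOrder (E := E) he) hs using 1
    rw [map_mul]
    linear_combination algebraMap K E δ * h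
  obtain ⟨s, hs, hus⟩ := mem_span_singleton_iff.1 hud
  have hrc : q * algebraMap K E c = algebraMap K E r⁻¹ := by
    rw [hq, ← map_mul]
    congr 1
    field_simp
  -- The factor `c` of `u - 1 = s c δ d` cancels `h(x, x) = r c` up to a unit, and `δ d` makes `h(y,
  -- x)` integral. This gives both stability of `L` and triviality on `L^∨ / L`.
  have hfO : ∀ y ∈ traceDual p H L, f u y ∈ maxOrder p E := by
    intro y hy
    rw [mem_traceDual_iff hE hσ hθ hδ hK] at hy
    convert mul_mem (mul_mem hs (algebraMap_mem_maxOrder (E := E) hri)) (hy x hx) using 1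
    rw [hf, hus, ← hrc, map_mul]
    ring
  have hfO' : ∀ y ∈ traceDual p H L, f ((u⁻¹ : Eˣ) : E) y ∈ maxOrder p E := by
    intro y hy
    convert neg_mem (mul_mem hu' (hfO y hy)) using 1
    rw [hf, hf]
    linear_combination q * H.form y x * u.inv_mul
  have hxL : ∀ a ∈ maxOrder p E, a • x ∈ L := fun a ha =>
    L.smul_mem (⟨a, ha⟩ : maxOrder p E) hx
  have hφL : ∀ y ∈ L, φ y ∈ L := fun y hy => by
    rw [hφ]; exact add_mem hy (hxL _ (hfO y (hLdual y hy)))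
  have hφL' : ∀ y ∈ L, φ.symm y ∈ L := fun y hy => by
    rw [hφ']; exact add_mem hy (hxL _ (hfO' y (hLdual y hy)))
  rw [mem_detSharp_iff]
  refine ⟨φ, fun y z => ?_, fun y => ⟨fun h => ?_, hφL y⟩, fun y hy => ?_, Units.ext ?_⟩
  · rw [hφ, hφ]
    simp only [map_add, LinearMap.add_apply, map_smul, LinearMap.smul_apply,
      LinearMap.map_smulₛₗ, smul_eq_mul]
    rw [H.conj_symm x z]
    have hσf : (σ : E →+* E) (f u z) = (σ u - 1) * q * σ (H.form z x) := by
      change σ (f u z) = _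
      rw [hf, map_mul, map_mul, hσq, map_sub, map_one]
    rw [hσf, hf]
    linear_combination (σ (u : E) - 1) * ((u : E) - 1) * q * H.form y x * σ (H.form z x) * hqx +
      q * H.form y x * σ (H.form z x) * hu1
  · have := hφL' _ h
    rwa [LinearEquiv.symm_apply_apply] at this
  · rw [hφ, add_sub_cancel_left]
    exact hxL _ (hfO y hy)
  · rw [LinearEquiv.coe_det]
    change LinearMap.det (LinearMap.transvection (f u) x) = _
    rw [LinearMap.transvection.det, hf, mul_assoc, hqx]
    ring

theorem detSharp_eq_normOneUnits (hL : IsFullLattice p L) {i : ℤ}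
    (hi : zpowIdeal (invIdeal p σ) i =
      Submodule.span (maxOrder p E) {algebraMap K E (c * δ) * (θ - σ θ)}) :
    detSharp p H L = normOneUnits p σ i := by
  ext u
  constructor
  · intro hu
    obtain ⟨φ, h1, h2, h3, rfl⟩ := mem_detSharp_iff.1 hu
    obtain ⟨h4, h5, h6, h7⟩ := det_mem_of_sharp hE hσ hθ hδ hK hc0 hc he hL h1 h3
    exact ⟨h4, h5, h6, hi ▸ h7⟩
  · rintro ⟨h4, h5, h6, h7⟩
    exact exists_sharp_det_eq hE hσ hθ hδ hK hc0 hc he hL h5 h6 (hi ▸ h7)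

end Determinants

end LocalHermitian

theorem mainTheorem11 (p : ℕ) [Fact p.Prime]
    (K : Type*) [Field K] [Algebra ℚ_[p] K] [FiniteDimensional ℚ_[p] K]
    [Algebra ℤ_[p] K] [IsScalarTower ℤ_[p] ℚ_[p] K]
    (E : Type*) [CommRing E] [Algebra K E] [Algebra.Etale K E]
    [Algebra ℚ_[p] E] [IsScalarTower ℚ_[p] K E]
    [Algebra ℤ_[p] E] [IsScalarTower ℤ_[p] ℚ_[p] E] [IsScalarTower ℤ_[p] K E]
    (hE : Module.finrank K E = 2)
    (σ : E ≃ₐ[K] E) (hσ : σ ≠ AlgEquiv.refl)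
    (a : ℤ) (ha : LocalHermitian.different p E =
      LocalHermitian.zpowIdeal (LocalHermitian.invIdeal p σ) a)
    (V : Type*) [AddCommGroup V] [Module E V] (H : LocalHermitian.HermitianForm σ V)
    (L : Submodule (LocalHermitian.maxOrder p E) V) (hL : LocalHermitian.IsFullLattice p L)
    (k : ℤ) (hk : LocalHermitian.latticeNorm p H L =
      LocalHermitian.zpowIdeal (LocalHermitian.maxIdeal p K) k)
    (heven : LocalHermitian.latticeNorm p H L ≤ LocalHermitian.inverseDifferent p K) :
    (LocalHermitian.IsRamified p σ →
      LocalHermitian.detSharp p H L = LocalHermitian.normOneUnits p σ (2 * k + a)) ∧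
    (¬ LocalHermitian.IsRamified p σ →
      LocalHermitian.detSharp p H L = LocalHermitian.normOneUnits p σ (k + a)) := by
  open LocalHermitian in
  have hchar : CharZero K := charZero_of_injective_algebraMap (algebraMap ℚ_[p] K).injective
  have hred : IsReduced E := Algebra.FormallyUnramified.isReduced_of_field K E
  obtain ⟨θ, hθ1, hθ2, hθ3⟩ := exists_maxOrder_gen (p := p) hE hσ
  have hθ : IsMaxOrderGen p K θ := ⟨hθ1, hθ2, hθ3⟩
  obtain ⟨δ, hδ, hK⟩ := exists_inverseDifferent_eq_span p K
  obtain ⟨π, hπ⟩ := exists_isUniformizer p K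
  rw [hθ.different_eq hE hσ hδ hK] at ha
  have hc : latticeNorm p H L = Submodule.span (maxOrder p K) {((π ^ k : Kˣ) : K)} := by
    rw [hk, hπ.maxIdeal_eq, zpowIdeal_span_unit]
  -- Evenness of the trace form enters only here.
  have he : ((π ^ k : Kˣ) : K) * δ ∈ maxOrder p K := by
    have h1 : ((π ^ k : Kˣ) : K) ∈ inverseDifferent p K :=
      heven (hc ▸ Submodule.mem_span_singleton_self _)
    rw [hK, mem_span_singleton_iff] at h1
    obtain ⟨r, hr, h1⟩ := h1
    rwa [h1, inv_mul_cancel_right₀ hδ]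
  set πE : Eˣ := Units.map (algebraMap K E).toMonoidHom π with hπE
  have hπk : ((πE ^ k : Eˣ) : E) = algebraMap K E ((π ^ k : Kˣ) : K) := by
    rw [hπE, ← map_zpow]; rfl
  have hspan : Submodule.span (maxOrder p E) {((πE ^ k : Eˣ) : E)} *
      zpowIdeal (invIdeal p σ) a = Submodule.span (maxOrder p E)
        {algebraMap K E (((π ^ k : Kˣ) : K) * δ) * (θ - σ θ)} := by
    rw [← ha, span_mul_span_singleton, hπk, map_mul, mul_assoc]
  refine ⟨fun hR => ?_, fun hR => ?_⟩
  · obtain ⟨⟨ϖ, hϖ, hϖ2⟩, -⟩ := hR.exists_residue hE hσ hπ hθ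
    refine detSharp_eq_normOneUnits hE hσ hθ hδ hK (Units.ne_zero _) hc he hL ?_
    -- `π` generates the same ideal as `ϖ²`, so `𝔭^k` contributes `2k` to the exponent of `𝔓`.
    rw [← hspan, hϖ, zpowIdeal_span_unit, zpowIdeal_span_unit,
      ← span_zpow_eq_of_span_eq (u := ϖ ^ 2) (v := πE) hϖ2, span_mul_span_singleton,
      ← Units.val_mul, zpow_add, zpow_mul]
    rfl
  · refine detSharp_eq_normOneUnits hE hσ hθ hδ hK (Units.ne_zero _) hc he hL ?_
    have h1 : invIdeal p σ = Submodule.span (maxOrder p E) {(πE : E)} :=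
      invIdeal_eq_of_not_isRamified hE hσ hR hπ
    rw [← hspan, h1, zpowIdeal_span_unit, zpowIdeal_span_unit, span_mul_span_singleton,
      ← Units.val_mul, zpow_add]
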